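/- Let $T>0$, let $\mathcal V,\mathcal H,\mathcal Q$ be real Hilbert spaces, and let $\mathcal V$ be continuously and densely embedded in $\mathcal H$, so that $\mathcal V,\mathcal H,\mathcal V^*$ is a Gelfand triple ($\mathcal H\cong\mathcal H^*\hookrightarrow\mathcal V^*$). Let $\mathcal B\in\mathcal L(\mathcal V,\mathcal Q^*)$ satisfy the inf-sup condition: there is $\beta>0$ with \[ \inf_{q\in\mathcal Q\setminus\{0\}}\ \sup_{v\in\mathcal V\setminus\{0\}}\frac{\langle \mathcal Bv,q\rangle}{\|v\|_{\mathcal V}\|q\|_{\mathcal Q}}\ \ge\ \beta . \] Let $\mathcal A\in\mathcal L(\mathcal V,\mathcal V^*)$ have the form $\mathcal A=\mathcal A_1+\mathcal A_2$ with $\mathcal A_1\in\mathcal L(\mathcal V,\mathcal V^*)$ self-adjoint and $\mathcal A_2\in\mathcal L(\mathcal V,\mathcal H)$, and let $\mathcal A$ be elliptic on $\ker\mathcal B$, i.e. there is $\mu>0$ with $\langle\mathcal Av,v\rangle\ge\mu\|v\|_{\mathcal V}^2$ for all $v\in\ker\mathcal B$. Let $g\in H^1(0,T;\mathcal Q^*)$,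 identified with its continuous representative on $[0,T]$. Let $f\colon[0,T]\times\mathcal V\to\mathcal H$ satisfy: (i) $v\mapsto f(t,v)$ is continuous for almost every $t\in[0,T]$, and $t\mapsto f(t,v)$ is (strongly) measurable for every $v\in\mathcal V$; (ii) there is $k\in L^2(0,T)$ such that $\|f(t,v)\|_{\mathcal H}\le k(t)(1+\|v\|_{\mathcal V})$ for every $v\in\mathcal V$ and almost every $t\in[0,T]$; (iii) for every $v\in\mathcal V$ there are $r=r(v)>0$ and $L=L(v)\ge0$ such that, for almost every $t\in[0,T]$, $\|f(t,v_1)-f(t,v_2)\|_{\mathcal H}\le L\|v_1-v_2\|_{\mathcal V}$ for all $v_1,v_2$ in the open ball $B_r(v)\subseteq\mathcal V$. Then for every $u_0\in\mathcal V$ with $\mathcal Bu_0=g(0)$ there is a unique pair \[ u\in C([0,T];\mathcal V)\cap H^1(0,T;\mathcal H),\qquad \lambda\in L^2(0,T;\mathcal Q) \] (with $\lambda$ unique up to equality almost everywhere) such that $u(0)=u_0$ and \[ \dot u(t)+\mathcal Au(t)+\mathcal B^*\lambda(t)=f(t,u(t))\ \text{ in }\mathcal V^*\ \text{for a.e. }t\in(0,T),\qquad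 \mathcal Bu(t)=g(t)\ \text{ in }\mathcal Q^*\ \text{for all }t\in[0,T], \] where $\dot u\in L^2(0,T;\mathcal H)$ is the weak derivative of $u$ and $\mathcal B^*\colon\mathcal Q\to\mathcal V^*$ is given by $\langle\mathcal B^*q,v\rangle=\langle\mathcal Bv,q\rangle$. -/

import Mathlib

open MeasureTheory Set
open scoped ContDiff

namespace PDAE

section TimeSpaces

variable {X : Type*} [NormedAddCommGroup X] [NormedSpace ℝ X]

/-- Lebesgue measure on the time interval `(0, T)`. -/
noncomputable def timeMeasure (T : ℝ) : Measure ℝ := volume.restrict (Ioo 0 T)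

/-- `w ∈ L²(0,T;X)` (Bochner space; `w` is a representative, values outside `(0,T)` are ignored). -/
def MemL2 (T : ℝ) (w : ℝ → X) : Prop := MemLp w 2 (timeMeasure T)

/-- `w, w' ∈ L²(0,T;X)` and `w'` is the weak (distributional) derivative of `w` on `(0,T)`. -/
structure HasH1Deriv (T : ℝ) (w w' : ℝ → X) : Prop where
  memL2 : MemL2 T w
  memL2_deriv : MemL2 T w'
  weak : ∀ φ : ℝ → ℝ, ContDiff ℝ ∞ φ → HasCompactSupport φ → tsupport φ ⊆ Ioo 0 T →
    ∫ t in Ioo 0 T, deriv φ t • w t = - ∫ t in Ioo 0 T, φ t • w' t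

/-- `w ∈ H¹(0,T;X)`. -/
def MemH1 (T : ℝ) (w : ℝ → X) : Prop := ∃ w' : ℝ → X, HasH1Deriv T w w'

end TimeSpaces

section Operators

variable {V H Q : Type*}
  [NormedAddCommGroup V] [InnerProductSpace ℝ V]
  [NormedAddCommGroup H] [InnerProductSpace ℝ H]
  [NormedAddCommGroup Q] [InnerProductSpace ℝ Q]

/-- `V, H, V*` is a Gelfand triple with embedding `ι`: continuous, injective, dense. -/
structure IsGelfandEmbedding (ι : V →L[ℝ] H) : Prop where
  injective : Function.Injective ι
  denseRange : DenseRange ι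

/-- The embedding `H ≅ H* ↪ V*`, i.e. `⟨h, v⟩ = (h, ι v)_H`. -/
noncomputable def toDualV (ι : V →L[ℝ] H) (h : H) : StrongDual ℝ V :=
  (innerSL ℝ h).comp ι

/-- The inf-sup condition. The infimum and the supremum are taken in the extended reals, where
the infimum over the empty set is `⊤` and the supremum over the empty set is `⊥`. -/
def InfSup (B : V →L[ℝ] StrongDual ℝ Q) : Prop :=
  ∃ β : ℝ, 0 < β ∧
    (β : EReal) ≤ ⨅ q : {q : Q // q ≠ 0}, ⨆ v : {v : V // v ≠ 0},
      ((B v.1 q.1 / (‖v.1‖ * ‖q.1‖) : ℝ) : EReal)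

/-- `A` is elliptic on the subspace `W` of `V`. -/
def EllipticOn (A : V →L[ℝ] StrongDual ℝ V) (W : Submodule ℝ V) : Prop :=
  ∃ μ : ℝ, 0 < μ ∧ ∀ v ∈ W, μ * ‖v‖ ^ 2 ≤ A v v

/-- `A = A₁ + A₂` with `A₁ ∈ L(V,V*)` self-adjoint and `A₂ ∈ L(V,H)`. -/
def HasSelfAdjointPrincipalPart (ι : V →L[ℝ] H) (A : V →L[ℝ] StrongDual ℝ V) : Prop :=
  ∃ (A₁ : V →L[ℝ] StrongDual ℝ V) (A₂ : V →L[ℝ] H),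
    (∀ v w : V, A₁ v w = A₁ w v) ∧ ∀ v : V, A v = A₁ v + toDualV ι (A₂ v)

/-- The Carathéodory conditions for `f : [0,T] × V → H`. -/
structure Caratheodory (T : ℝ) (f : ℝ → V → H) : Prop where
  continuous : ∀ᵐ t ∂timeMeasure T, Continuous (f t)
  measurable : ∀ v : V, AEStronglyMeasurable (fun t => f t v) (timeMeasure T)

/-- The bound `‖f(t,v)‖_H ≤ k(t) (1 + ‖v‖_V)` with some `k ∈ L²(0,T)`. -/
def LinearGrowth (T : ℝ) (f : ℝ → V → H) : Prop :=
  ∃ k : ℝ → ℝ, MemL2 T k ∧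
    ∀ v : V, ∀ᵐ t ∂timeMeasure T, ‖f t v‖ ≤ k t * (1 + ‖v‖)

/-- Local Lipschitz continuity in the second argument, with radius and constant that do not
depend on `t`. -/
def LocallyLipschitzInState (T : ℝ) (f : ℝ → V → H) : Prop :=
  ∀ v : V, ∃ r : ℝ, 0 < r ∧ ∃ L : ℝ, 0 ≤ L ∧ ∀ᵐ t ∂timeMeasure T,
    ∀ v₁ ∈ Metric.ball v r, ∀ v₂ ∈ Metric.ball v r, ‖f t v₁ - f t v₂‖ ≤ L * ‖v₁ - v₂‖

/-- `(u, lam)` with `u ∈ C([0,T];V) ∩ H¹(0,T;H)` and `lam ∈ L²(0,T;Q)` solves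
`u' + A u + B* lam = f(t,u)` in `V*` for almost every `t`, `B u = g` in `Q*`, `u(0) = u₀`.
The dual operator `B* : Q → V*` is `B.flip`, i.e. `⟨B* q, v⟩ = ⟨B v, q⟩`. -/
structure IsSolution (T : ℝ) (ι : V →L[ℝ] H) (A : V →L[ℝ] StrongDual ℝ V)
    (B : V →L[ℝ] StrongDual ℝ Q) (f : ℝ → V → H) (g : ℝ → StrongDual ℝ Q) (u₀ : V)
    (u : ℝ → V) (lam : ℝ → Q) : Prop where
  continuousOn : ContinuousOn u (Icc 0 T)
  memL2 : MemL2 T lam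
  dynamic : ∃ u' : ℝ → H, HasH1Deriv T (fun t => ι (u t)) u' ∧
    ∀ᵐ t ∂timeMeasure T,
      toDualV ι (u' t) + A (u t) + B.flip (lam t) = toDualV ι (f t (u t))
  constraint : ∀ t ∈ Icc 0 T, B (u t) = g t
  initial : u 0 = u₀

end Operators

end PDAE

set_option linter.unusedSectionVars false

namespace PDAE

/-! ### Bochner functions on the time interval, primitives and a product rule. -/

section TimeTools

variable {X Y : Type*} [NormedAddCommGroup X] [NormedSpace ℝ X]
  [NormedAddCommGroup Y] [NormedSpace ℝ Y] {T : ℝ}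

/-! The multiplier and the constraint are eliminated first. Adding a large multiple of the `H`-inner
product to the self-adjoint part of `A` gives a symmetric form `a` that is coercive on `ker B`; the
remainder is an operator `D : V → H`, absorbed into `f` (`exists_shifted_form`). The inf-sup
condition gives a bounded right inverse of `B`, which an `a`-projection makes `a`-orthogonal to `ker
B` (`exists_orthogonal_rightInverse`). With this right inverse `G`, write `u = G g + z`. Then `z`
takes values in `ker B` and, tested on `ker B`, solves `z' + a z = f(t, u) + D u - G g'`; by
orthogonality `G g` leaves no term with `a`.

The linear problem has maximal regularity: testing with `z'` bounds `‖z(t)‖²` in `V` by the initial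
value in `V` and the `L²(0,t;H)` norm of the right-hand side (`exists_linear_evolution`). This is
proved for solutions `R (h₀ + ∫ g)`, with `R` the inverse of the form, where all computations are
explicit, and extended by density of their data. No semigroup or Galerkin scheme is involved.

The semilinear problem becomes a fixed point equation in `C([0,T];V)` for a causal map. Over a time
step its Lipschitz factor is a multiple of the square root of the step length, so solutions are
locally unique and can be continued. Linear growth with `k ∈ L²` excludes blow-up, so they reach `T`
(`existsUnique_fixedPoint_of_causal`, `existsUnique_constrained_evolution`).

Finally the residual `f - u' - A u` vanishes on `ker B` and hence equals `B* λ`, where `λ` is a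
bounded linear image of the residual and so lies in `L²` (`exists_multiplier_map`). Injectivity of
`B*` makes `λ` unique. Weak derivatives enter only through `hasH1Deriv_of_eq_primitive`,
`HasH1Deriv.eq_primitive` and `HasH1Deriv.deriv_ae_eq`. -/

lemma timeMeasure_eq_restrict_Ioc (T : ℝ) : timeMeasure T = volume.restrict (Ioc 0 T) :=
  Measure.restrict_congr_set Ioo_ae_eq_Ioc

instance isFiniteMeasure_timeMeasure (T : ℝ) : IsFiniteMeasure (timeMeasure T) := by
  unfold timeMeasure; infer_instance

lemma timeMeasure_restrict_Ioc {t : ℝ} (ht : t ∈ Icc 0 T) :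
    (timeMeasure T).restrict (Ioc 0 t) = volume.restrict (Ioc 0 t) := by
  rw [timeMeasure_eq_restrict_Ioc, Measure.restrict_restrict measurableSet_Ioc,
    inter_eq_left.2 (Ioc_subset_Ioc_right ht.2)]

lemma ae_restrict_Ioc_of_ae_timeMeasure {p : ℝ → Prop} (h : ∀ᵐ s ∂timeMeasure T, p s) {t : ℝ}
    (ht : t ∈ Icc 0 T) : ∀ᵐ s ∂volume.restrict (Ioc 0 t), p s := by
  rw [← timeMeasure_restrict_Ioc ht]
  exact ae_restrict_of_ae h

lemma ae_timeMeasure_mem_Ioo (T : ℝ) : ∀ᵐ s ∂timeMeasure T, s ∈ Ioo 0 T :=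
  ae_restrict_mem measurableSet_Ioo

lemma intervalIntegrable_of_integrable {g : ℝ → X} (hg : Integrable g (timeMeasure T)) {s t : ℝ}
    (hs : s ∈ Icc 0 T) (ht : t ∈ Icc 0 T) : IntervalIntegrable g volume s t := by
  rw [timeMeasure_eq_restrict_Ioc] at hg
  refine intervalIntegrable_iff.2 (IntegrableOn.mono_set hg fun x hx => ?_)
  rcases uIoc_subset_uIcc hx with ⟨h1, h2⟩
  rw [mem_uIoc] at hx
  rcases hx with hx | hx
  · exact ⟨hs.1.trans_lt hx.1, hx.2.trans ht.2⟩
  · exact ⟨ht.1.trans_lt hx.1, hx.2.trans hs.2⟩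

lemma MemL2.integrable {g : ℝ → X} (hg : MemL2 T g) : Integrable g (timeMeasure T) :=
  MemLp.integrable one_le_two hg

lemma integrable_coe_Lp (g : Lp X 2 (timeMeasure T)) : Integrable g (timeMeasure T) :=
  MemL2.integrable (Lp.memLp g)

lemma intervalIntegral_congr_of_ae {g h : ℝ → X} (hgh : g =ᵐ[timeMeasure T] h) {t : ℝ}
    (ht : t ∈ Icc 0 T) : ∫ s in (0 : ℝ)..t, g s = ∫ s in (0 : ℝ)..t, h s := by
  rw [intervalIntegral.integral_of_le ht.1, intervalIntegral.integral_of_le ht.1]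
  exact integral_congr_ae (ae_restrict_Ioc_of_ae_timeMeasure hgh ht)

lemma integral_timeMeasure (hT : 0 ≤ T) (g : ℝ → X) :
    ∫ s, g s ∂timeMeasure T = ∫ s in (0 : ℝ)..T, g s := by
  rw [timeMeasure_eq_restrict_Ioc, intervalIntegral.integral_of_le hT]

lemma norm_primitive_le {g : ℝ → X} (hg : Integrable g (timeMeasure T)) {t : ℝ}
    (ht : t ∈ Icc 0 T) : ‖∫ s in (0 : ℝ)..t, g s‖ ≤ ∫ s, ‖g s‖ ∂timeMeasure T := by
  rw [intervalIntegral.integral_of_le ht.1, ← timeMeasure_restrict_Ioc ht]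
  refine (norm_integral_le_integral_norm _).trans ?_
  exact setIntegral_le_integral hg.norm (ae_of_all _ fun _ => norm_nonneg _)

lemma exists_integral_norm_le_L2 (T : ℝ) (X : Type*) [NormedAddCommGroup X] :
    ∃ K : ℝ, 0 ≤ K ∧ ∀ g : Lp X 2 (timeMeasure T), ∫ s, ‖g s‖ ∂timeMeasure T ≤ K * ‖g‖ := by
  refine ⟨((timeMeasure T univ) ^ (1 / (1 : ENNReal).toReal - 1 / (2 : ENNReal).toReal)).toReal,
    ENNReal.toReal_nonneg, fun g => ?_⟩
  have hm := (Lp.memLp g).aestronglyMeasurable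
  rw [integral_norm_eq_lintegral_enorm hm, ← eLpNorm_one_eq_lintegral_enorm, mul_comm, Lp.norm_def,
    ← ENNReal.toReal_mul]
  refine ENNReal.toReal_mono (ENNReal.mul_ne_top (Lp.eLpNorm_ne_top g) ?_)
    (eLpNorm_le_eLpNorm_mul_rpow_measure_univ one_le_two hm)
  exact ENNReal.rpow_ne_top_of_nonneg (by norm_num) (measure_ne_top _ _)

lemma continuous_primitive {g : ℝ → X} (hT : 0 ≤ T) (hg : Integrable g (timeMeasure T)) :
    Continuous fun t : Icc 0 T => ∫ s in (0 : ℝ)..t, g s := by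
  have h : ContinuousOn (fun t => ∫ s in (0 : ℝ)..t, g s) (uIcc 0 T) := by
    refine intervalIntegral.continuousOn_primitive_interval ?_
    rw [uIcc_of_le hT, integrableOn_Icc_iff_integrableOn_Ioc]
    rwa [timeMeasure_eq_restrict_Ioc] at hg
  rw [uIcc_of_le hT] at h
  exact continuousOn_iff_continuous_domRestrict.1 h

/-- The primitive `t ↦ ∫₀ᵗ g` as a bounded operator `L²(0,T;X) → C([0,T];X)`. -/
noncomputable def primitive (hT : 0 ≤ T) : Lp X 2 (timeMeasure T) →L[ℝ] C(Icc 0 T, X) :=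
  LinearMap.mkContinuousOfExistsBound
    { toFun := fun g => ⟨fun t => ∫ s in (0 : ℝ)..t, g s,
        continuous_primitive hT (integrable_coe_Lp g)⟩
      map_add' := fun g h => by
        ext t
        have h0 : (0 : ℝ) ∈ Icc 0 T := ⟨le_rfl, hT⟩
        simp only [ContinuousMap.coe_mk, ContinuousMap.add_apply]
        rw [intervalIntegral_congr_of_ae (Lp.coeFn_add g h) t.2]
        exact intervalIntegral.integral_add
          (intervalIntegrable_of_integrable (integrable_coe_Lp g) h0 t.2)
          (intervalIntegrable_of_integrable (integrable_coe_Lp h) h0 t.2)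
      map_smul' := fun c g => by
        ext t
        simp only [ContinuousMap.coe_mk, ContinuousMap.smul_apply, RingHom.id_apply]
        rw [intervalIntegral_congr_of_ae (Lp.coeFn_smul c g) t.2]
        exact intervalIntegral.integral_smul c _ }
    (by
      obtain ⟨K, hK, h⟩ := exists_integral_norm_le_L2 T X
      refine ⟨K, fun g => (ContinuousMap.norm_le _ (by positivity)).2 fun t => ?_⟩
      exact (norm_primitive_le (integrable_coe_Lp g) t.2).trans (h g))

lemma primitive_apply (hT : 0 ≤ T) (g : Lp X 2 (timeMeasure T)) (t : Icc 0 T) :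
    primitive hT g t = ∫ s in (0 : ℝ)..t, g s := rfl

lemma memL2_of_continuous {w : ℝ → X} (hw : Continuous w) : MemL2 T w := by
  have : IsFiniteMeasure (volume.restrict (Icc 0 T)) := by infer_instance
  have h : MemLp w 2 (volume.restrict (Icc 0 T)) := by
    obtain ⟨C, hC⟩ := (isCompact_Icc (a := (0 : ℝ)) (b := T)).exists_bound_of_continuousOn
      hw.continuousOn
    exact MemLp.of_bound hw.aestronglyMeasurable C
      ((ae_restrict_iff' measurableSet_Icc).2 (ae_of_all _ hC))
  exact h.mono_measure (Measure.restrict_mono Ioo_subset_Icc_self le_rfl)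

lemma memL2_IccExtend (hT : 0 ≤ T) (u : C(Icc 0 T, X)) :
    MemLp (IccExtend hT u) 2 (timeMeasure T) :=
  memL2_of_continuous u.continuous.Icc_extend'

/-- The inclusion of `C([0,T];X)` in `L²(0,T;X)`. -/
noncomputable def contToL2 (hT : 0 ≤ T) : C(Icc 0 T, X) →L[ℝ] Lp X 2 (timeMeasure T) :=
  LinearMap.mkContinuousOfExistsBound
    { toFun := fun u => MemLp.toLp _ (memL2_IccExtend hT u)
      map_add' := fun _ _ => rfl
      map_smul' := fun _ _ => rfl }
    (by
      refine ⟨_, fun u => Lp.norm_le_of_ae_bound (norm_nonneg u) ?_⟩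
      filter_upwards [MemLp.coeFn_toLp (memL2_IccExtend hT u)] with t ht
      refine (congrArg norm ht).le.trans ?_
      exact u.norm_coe_le_norm _)

lemma coeFn_contToL2 (hT : 0 ≤ T) (u : C(Icc 0 T, X)) :
    contToL2 hT u =ᵐ[timeMeasure T] IccExtend hT u :=
  MemLp.coeFn_toLp (memL2_IccExtend hT u)

lemma contToL2_ae (hT : 0 ≤ T) (u : C(Icc 0 T, X)) :
    ∀ᵐ s ∂timeMeasure T, ∀ hs : s ∈ Icc 0 T, contToL2 hT u s = u ⟨s, hs⟩ := by
  filter_upwards [coeFn_contToL2 hT u] with s h hs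
  rw [h, IccExtend_of_mem hT u hs]

lemma eq_of_contToL2_eq (hT : 0 < T) {u v : C(Icc 0 T, X)}
    (h : contToL2 hT.le u = contToL2 hT.le v) : u = v := by
  have h1 : IccExtend hT.le u =ᵐ[volume.restrict (Ioo 0 T)] IccExtend hT.le v :=
    (coeFn_contToL2 hT.le u).symm.trans (h ▸ coeFn_contToL2 hT.le v)
  have h2 := Measure.eqOn_of_ae_eq h1 (u.continuous.Icc_extend').continuousOn
    (v.continuous.Icc_extend').continuousOn (by
      rw [interior_Ioo]; exact subset_closure)
  have h3 := h2.closure (u.continuous.Icc_extend') (v.continuous.Icc_extend')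
  rw [closure_Ioo hT.ne] at h3
  ext t
  simpa [IccExtend_val] using h3 t.2

/-- As the norm of a bounded restriction operator, the integral over `(0, t)` is continuous in `F`;
this lets the energy estimate pass to limits. -/
lemma integral_norm_sq_restrict (F : Lp X 2 (timeMeasure T)) {t : ℝ} (ht : t ∈ Icc 0 T) :
    ∫ s in (0 : ℝ)..t, ‖F s‖ ^ 2 = ‖LpToLpRestrictCLM ℝ X ℝ (timeMeasure T) 2 (Ioc 0 t) F‖ ^ 2 := by
  have hm := (Lp.memLp (LpToLpRestrictCLM ℝ X ℝ (timeMeasure T) 2 (Ioc 0 t) F))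
  rw [Lp.norm_def, hm.eLpNorm_eq_integral_rpow_norm two_ne_zero ENNReal.ofNat_ne_top,
    ENNReal.toReal_ofReal (by positivity), ENNReal.toReal_ofNat, ← Real.rpow_natCast,
    ← Real.rpow_mul (integral_nonneg fun _ => by positivity)]
  norm_num
  rw [intervalIntegral.integral_of_le ht.1, ← timeMeasure_restrict_Ioc ht]
  refine integral_congr_ae ?_
  filter_upwards [LpToLpRestrictCLM_coeFn ℝ (Ioc 0 t) F] with s hs
  rw [hs]

lemma continuous_integral_norm_sq {t : ℝ} (ht : t ∈ Icc 0 T) :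
    Continuous fun F : Lp X 2 (timeMeasure T) => ∫ s in (0 : ℝ)..t, ‖F s‖ ^ 2 := by
  simp_rw [fun F => integral_norm_sq_restrict F ht]
  fun_prop

lemma integrable_norm_sq {F : ℝ → X} (hF : MemL2 T F) :
    Integrable (fun s => ‖F s‖ ^ 2) (timeMeasure T) :=
  (memLp_two_iff_integrable_sq_norm hF.aestronglyMeasurable).1 hF

lemma norm_sq_eq_integral (hT : 0 ≤ T) (F : Lp X 2 (timeMeasure T)) :
    ‖F‖ ^ 2 = ∫ s in (0 : ℝ)..T, ‖F s‖ ^ 2 := by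
  rw [Lp.norm_def, (Lp.memLp F).eLpNorm_eq_integral_rpow_norm two_ne_zero ENNReal.ofNat_ne_top,
    ENNReal.toReal_ofReal (by positivity), ENNReal.toReal_ofNat, ← Real.rpow_natCast,
    ← Real.rpow_mul (integral_nonneg fun _ => by positivity)]
  norm_num
  exact integral_timeMeasure hT _

lemma absolutelyContinuousOnInterval_of_dist_le {f : ℝ → X} {p : ℝ → Y} {a b : ℝ}
    (hp : AbsolutelyContinuousOnInterval p a b)
    (h : ∀ s ∈ uIcc a b, ∀ t ∈ uIcc a b, dist (f s) (f t) ≤ dist (p s) (p t)) :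
    AbsolutelyContinuousOnInterval f a b := by
  rw [absolutelyContinuousOnInterval_iff] at hp ⊢
  intro ε hε
  obtain ⟨δ, hδ, H⟩ := hp ε hε
  refine ⟨δ, hδ, fun E hE hs => lt_of_le_of_lt (Finset.sum_le_sum fun i hi => ?_) (H E hE hs)⟩
  exact h _ (hE.1 i hi).1 _ (hE.1 i hi).2

/-- The product rule for two primitives and a bounded bilinear form. -/
theorem intervalIntegrable_and_bilin_primitive_eq [CompleteSpace X] [CompleteSpace Y] (b : X →L[ℝ] Y →L[ℝ] ℝ) {t : ℝ}
    (ht : 0 ≤ t) {g : ℝ → X} {h : ℝ → Y} (hg : IntervalIntegrable g volume 0 t)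
    (hh : IntervalIntegrable h volume 0 t) (x₀ : X) (y₀ : Y) :
    IntervalIntegrable (fun s => b (g s) (y₀ + ∫ r in (0 : ℝ)..s, h r) +
      b (x₀ + ∫ r in (0 : ℝ)..s, g r) (h s)) volume 0 t ∧
    b (x₀ + ∫ s in (0 : ℝ)..t, g s) (y₀ + ∫ s in (0 : ℝ)..t, h s) = b x₀ y₀ +
      ∫ s in (0 : ℝ)..t, (b (g s) (y₀ + ∫ r in (0 : ℝ)..s, h r) +
        b (x₀ + ∫ r in (0 : ℝ)..s, g r) (h s)) := by
  set y : ℝ → X := fun s => x₀ + ∫ r in (0 : ℝ)..s, g r with hy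
  set z : ℝ → Y := fun s => y₀ + ∫ r in (0 : ℝ)..s, h r with hz
  have h0 : (0 : ℝ) ∈ uIcc 0 t := left_mem_uIcc
  have hsub : ∀ {s r}, s ∈ uIcc 0 t → r ∈ uIcc 0 t → uIcc s r ⊆ uIcc 0 t :=
    fun hs hr => uIcc_subset_uIcc hs hr
  have ydist : ∀ s ∈ uIcc 0 t, ∀ r ∈ uIcc 0 t, s ≤ r →
      ‖y r - y s‖ ≤ ∫ x in s..r, ‖g x‖ := by
    intro s hs r hr hsr
    have : y r - y s = ∫ x in s..r, g x := by
      simp only [hy, add_sub_add_left_eq_sub]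
      exact intervalIntegral.integral_interval_sub_left (hg.mono_set (hsub h0 hr))
        (hg.mono_set (hsub h0 hs))
    rw [this]
    exact intervalIntegral.norm_integral_le_integral_norm hsr
  have zdist : ∀ s ∈ uIcc 0 t, ∀ r ∈ uIcc 0 t, s ≤ r →
      ‖z r - z s‖ ≤ ∫ x in s..r, ‖h x‖ := by
    intro s hs r hr hsr
    have : z r - z s = ∫ x in s..r, h x := by
      simp only [hz, add_sub_add_left_eq_sub]
      exact intervalIntegral.integral_interval_sub_left (hh.mono_set (hsub h0 hr))
        (hh.mono_set (hsub h0 hs))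
    rw [this]
    exact intervalIntegral.norm_integral_le_integral_norm hsr
  set My : ℝ := ‖x₀‖ + ∫ x in (0 : ℝ)..t, ‖g x‖ with hMy
  set Mz : ℝ := ‖y₀‖ + ∫ x in (0 : ℝ)..t, ‖h x‖ with hMz
  have ybd : ∀ s ∈ uIcc 0 t, ‖y s‖ ≤ My := by
    intro s hs
    have hs' := hs
    rw [uIcc_of_le ht] at hs'
    refine (norm_add_le _ _).trans (add_le_add_right ?_ _)
    refine (intervalIntegral.norm_integral_le_integral_norm hs'.1).trans ?_
    exact intervalIntegral.integral_mono_interval le_rfl hs'.1 hs'.2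
      (ae_of_all _ fun _ => norm_nonneg _) hg.norm
  have zbd : ∀ s ∈ uIcc 0 t, ‖z s‖ ≤ Mz := by
    intro s hs
    have hs' := hs
    rw [uIcc_of_le ht] at hs'
    refine (norm_add_le _ _).trans (add_le_add_right ?_ _)
    refine (intervalIntegral.norm_integral_le_integral_norm hs'.1).trans ?_
    exact intervalIntegral.integral_mono_interval le_rfl hs'.1 hs'.2
      (ae_of_all _ fun _ => norm_nonneg _) hh.norm
  -- The primitive of `k` dominates the increments of `b (y s) (z s)`, which is therefore absolutely
  -- continuous. Being scalar, it is the integral of its derivative, and that is known almost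
  -- everywhere by Lebesgue differentiation.
  set k : ℝ → ℝ := fun s => ‖b‖ * (Mz * ‖g s‖ + My * ‖h s‖) with hk
  have hki : IntervalIntegrable k volume 0 t :=
    ((hg.norm.const_mul _).add (hh.norm.const_mul _)).const_mul _
  have key : ∀ s ∈ uIcc 0 t, ∀ r ∈ uIcc 0 t, s ≤ r →
      ‖b (y r) (z r) - b (y s) (z s)‖ ≤ ∫ x in s..r, k x := by
    intro s hs r hr hsr
    have e : b (y r) (z r) - b (y s) (z s) = b (y r - y s) (z r) + b (y s) (z r - z s) := by
      simp
    have i1 : IntervalIntegrable (fun x => Mz * ‖g x‖) volume s r :=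
      (hg.norm.const_mul _).mono_set (hsub hs hr)
    have i2 : IntervalIntegrable (fun x => My * ‖h x‖) volume s r :=
      (hh.norm.const_mul _).mono_set (hsub hs hr)
    have ek : ∫ x in s..r, k x =
        ‖b‖ * (Mz * (∫ x in s..r, ‖g x‖) + My * ∫ x in s..r, ‖h x‖) := by
      simp only [hk]
      rw [intervalIntegral.integral_const_mul, intervalIntegral.integral_add i1 i2,
        intervalIntegral.integral_const_mul, intervalIntegral.integral_const_mul]
    rw [e, ek]
    have b1 : ‖b (y r - y s) (z r)‖ ≤ ‖b‖ * (∫ x in s..r, ‖g x‖) * Mz :=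
      (b.le_opNorm₂ _ _).trans (by
        gcongr
        · exact mul_nonneg b.opNorm_nonneg (intervalIntegral.integral_nonneg hsr
            fun _ _ => norm_nonneg _)
        · exact ydist s hs r hr hsr
        · exact zbd r hr)
    have b2 : ‖b (y s) (z r - z s)‖ ≤ ‖b‖ * My * (∫ x in s..r, ‖h x‖) :=
      (b.le_opNorm₂ _ _).trans (by
        gcongr
        · exact mul_nonneg b.opNorm_nonneg ((norm_nonneg _).trans (ybd s hs))
        · exact ybd s hs
        · exact zdist s hs r hr hsr)
    calc _ ≤ _ := norm_add_le _ _
      _ ≤ _ := add_le_add b1 b2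
      _ = _ := by ring
  have hac : AbsolutelyContinuousOnInterval (fun s => b (y s) (z s)) 0 t := by
    refine absolutelyContinuousOnInterval_of_dist_le
      (hki.absolutelyContinuousOnInterval_intervalIntegral h0) ?_
    have main : ∀ s ∈ uIcc 0 t, ∀ r ∈ uIcc 0 t, s ≤ r → dist (b (y s) (z s)) (b (y r) (z r)) ≤
        dist (∫ x in (0 : ℝ)..s, k x) (∫ x in (0 : ℝ)..r, k x) := by
      intro s hs r hr hsr
      rw [dist_comm, dist_comm (∫ x in (0 : ℝ)..s, k x), dist_eq_norm, dist_eq_norm,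
        intervalIntegral.integral_interval_sub_left (hki.mono_set (hsub h0 hr))
          (hki.mono_set (hsub h0 hs))]
      exact (key s hs r hr hsr).trans (Real.le_norm_self _)
    intro s hs r hr
    rcases le_total s r with hsr | hsr
    · exact main s hs r hr hsr
    · rw [dist_comm, dist_comm (∫ x in (0 : ℝ)..s, k x)]
      exact main r hr s hs hsr
  have hint := hac.integral_deriv_eq_sub
  have hd : ∀ᵐ s, s ∈ uIoc 0 t →
      deriv (fun s => b (y s) (z s)) s = b (g s) (z s) + b (y s) (h s) := by
    filter_upwards [hg.ae_hasDerivAt_integral, hh.ae_hasDerivAt_integral] with s h1 h2 hs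
    have hs' := uIoc_subset_uIcc hs
    have d1 : HasDerivAt y (g s) s := (h1 hs' 0 h0).const_add _
    have d2 : HasDerivAt z (h s) s := (h2 hs' 0 h0).const_add _
    exact ((b.hasFDerivAt.comp_hasDerivAt s d1).clm_apply d2).deriv
  refine ⟨hac.intervalIntegrable_deriv.congr_ae
    ((ae_restrict_iff' measurableSet_uIoc).2 hd), ?_⟩
  rw [intervalIntegral.integral_congr_ae hd] at hint
  rw [hint]
  simp [hy, hz]

end TimeTools

/-! ### Maximal regularity for the linear evolution equation with a symmetric coercive form. -/

section LinearSolver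

variable {W H : Type*}
  [NormedAddCommGroup W] [InnerProductSpace ℝ W] [CompleteSpace W]
  [NormedAddCommGroup H] [InnerProductSpace ℝ H] [CompleteSpace H] {T : ℝ}

local notation "⟪" x ", " y "⟫" => inner ℝ x y

/-- The solution operator `H → W` of `a(u, v) = (h, j v)_H`. -/
noncomputable def formInverse {a : W →L[ℝ] W →L[ℝ] ℝ} (ha : IsCoercive a) (j : W →L[ℝ] H) :
    H →L[ℝ] W :=
  (ha.continuousLinearEquivOfBilin.symm : W →L[ℝ] W).comp j.adjoint

lemma formInverse_spec {a : W →L[ℝ] W →L[ℝ] ℝ} (ha : IsCoercive a) (j : W →L[ℝ] H) (h : H)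
    (v : W) : a (formInverse ha j h) v = ⟪h, j v⟫ := by
  rw [← ha.continuousLinearEquivOfBilin_apply]
  simp [formInverse, ContinuousLinearMap.adjoint_inner_left]

lemma IsCoercive.eq_zero_of_apply_self_nonpos {a : W →L[ℝ] W →L[ℝ] ℝ} (ha : IsCoercive a) {v : W}
    (h : a v v ≤ 0) : v = 0 := by
  obtain ⟨c, hc, hac⟩ := ha
  have h1 := hac v
  have h2 : ‖v‖ * ‖v‖ ≤ 0 := by
    by_contra! h3
    nlinarith [mul_pos hc h3]
  exact norm_eq_zero.1 (mul_self_eq_zero.1 (le_antisymm h2 (mul_self_nonneg _)))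

lemma eq_formInverse {a : W →L[ℝ] W →L[ℝ] ℝ} (ha : IsCoercive a) (j : W →L[ℝ] H) {h : H} {u : W}
    (hu : ∀ v, a u v = ⟪h, j v⟫) : u = formInverse ha j h := by
  refine sub_eq_zero.1 (IsCoercive.eq_zero_of_apply_self_nonpos ha ?_)
  have := hu (u - formInverse ha j h)
  have h2 := formInverse_spec ha j h (u - formInverse ha j h)
  rw [map_sub a, sub_apply, this, h2, sub_self]

/-- A function in `L²(0,T;X)` whose primitive vanishes is zero. -/
lemma eq_zero_of_primitive_eq_zero (hT : 0 ≤ T) {G : Lp H 2 (timeMeasure T)}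
    (h : primitive hT G = 0) : G = 0 := by
  have h0 : (0 : ℝ) ∈ Icc 0 T := ⟨le_rfl, hT⟩
  have hTm : T ∈ Icc 0 T := ⟨hT, le_rfl⟩
  have hi := intervalIntegrable_of_integrable (integrable_coe_Lp G) h0 hTm
  have key : ∀ᵐ s ∂timeMeasure T, (G : ℝ → H) s = 0 := by
    refine (ae_restrict_iff' measurableSet_Ioo).2 ?_
    filter_upwards [hi.ae_hasDerivAt_integral] with s hs hsm
    have hd := hs (by rw [uIcc_of_le hT]; exact Ioo_subset_Icc_self hsm) 0 left_mem_uIcc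
    have hz : HasDerivAt (fun x => ∫ r in (0 : ℝ)..x, G r) 0 s := by
      refine (hasDerivAt_const s (0 : H)).congr_of_eventuallyEq ?_
      filter_upwards [isOpen_Ioo.mem_nhds hsm] with x hx
      exact DFunLike.congr_fun h ⟨x, Ioo_subset_Icc_self hx⟩
    exact hd.unique hz
  exact (Lp.eq_zero_iff_ae_eq_zero).2 key

/-- Integration by parts. For `g = h` it says that `g ↦ ∫ g` is a monotone operator on `L²`, the
source of both density and uniqueness below. -/
lemma inner_contToL2_primitive (hT : 0 ≤ T) (g h : Lp H 2 (timeMeasure T)) :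
    ⟪contToL2 hT (primitive hT g), h⟫ + ⟪g, contToL2 hT (primitive hT h)⟫ =
      ⟪∫ s in (0 : ℝ)..T, g s, ∫ s in (0 : ℝ)..T, h s⟫ := by
  have h0 : (0 : ℝ) ∈ Icc 0 T := ⟨le_rfl, hT⟩
  have hTm : T ∈ Icc 0 T := ⟨hT, le_rfl⟩
  have key := (intervalIntegrable_and_bilin_primitive_eq (innerSL ℝ (E := H)) hT
    (intervalIntegrable_of_integrable (integrable_coe_Lp g) h0 hTm)
    (intervalIntegrable_of_integrable (integrable_coe_Lp h) h0 hTm) 0 0).2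
  simp only [zero_add, map_zero] at key
  change ⟪_, _⟫ = ∫ s in (0 : ℝ)..T, (⟪_, _⟫ + ⟪_, _⟫) at key
  rw [key, L2.inner_def, L2.inner_def, ← integral_add (L2.integrable_inner _ _)
    (L2.integrable_inner _ _), ← integral_timeMeasure hT]
  refine integral_congr_ae ?_
  filter_upwards [contToL2_ae hT (primitive hT g), contToL2_ae hT (primitive hT h),
    ae_timeMeasure_mem_Ioo T] with s h1 h2 hs
  rw [h1 (Ioo_subset_Icc_self hs), h2 (Ioo_subset_Icc_self hs), primitive_apply, primitive_apply,
    add_comm]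

/-- Shows that `j R`, with `R` the inverse of the form, is symmetric and nonnegative on `L²(0,T;H)`.
-/
lemma inner_compLp_formInverse {a : W →L[ℝ] W →L[ℝ] ℝ} (ha : IsCoercive a)
    (hsym : ∀ v w, a v w = a w v) (j : W →L[ℝ] H) (g h : Lp H 2 (timeMeasure T)) :
    ⟪(j.comp (formInverse ha j)).compLpL 2 (timeMeasure T) g, h⟫ =
      ∫ s, a (formInverse ha j (g s)) (formInverse ha j (h s)) ∂timeMeasure T := by
  rw [L2.inner_def]
  refine integral_congr_ae ?_
  filter_upwards [(j.comp (formInverse ha j)).coeFn_compLpL (p := 2) (μ := timeMeasure T) g]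
    with s hs
  rw [hs, hsym, formInverse_spec, real_inner_comm]
  rfl

/-- `t ↦ h₀ + ∫₀ᵗ g` as a linear function of `(h₀, g)`. -/
noncomputable def affinePrimitive (hT : 0 ≤ T) :
    H × Lp H 2 (timeMeasure T) →ₗ[ℝ] C(Icc 0 T, H) where
  toFun p := ContinuousMap.const _ p.1 + primitive hT p.2
  map_add' p q := by ext t; simp; abel
  map_smul' c p := by ext t; simp

lemma affinePrimitive_apply (hT : 0 ≤ T) (p : H × Lp H 2 (timeMeasure T)) (t : Icc 0 T) :
    affinePrimitive hT p t = p.1 + ∫ s in (0 : ℝ)..t, p.2 s := rfl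

/-- The data `(u(0), u' + 𝒜 u)` of the regular solution `u = R (h₀ + ∫ g)`, where `R` is the
inverse of the form. -/
noncomputable def regularData {a : W →L[ℝ] W →L[ℝ] ℝ} (ha : IsCoercive a) (j : W →L[ℝ] H)
    (hT : 0 ≤ T) :
    H × Lp H 2 (timeMeasure T) →ₗ[ℝ] WithLp 2 (W × Lp H 2 (timeMeasure T)) :=
  (WithLp.linearEquiv 2 ℝ (W × Lp H 2 (timeMeasure T))).symm.toLinearMap ∘ₗ
    LinearMap.prod ((formInverse ha j).toLinearMap ∘ₗ LinearMap.fst ℝ _ _)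
      (((j.comp (formInverse ha j)).compLpL 2 (timeMeasure T)).toLinearMap ∘ₗ
        LinearMap.snd ℝ _ _ + (contToL2 hT).toLinearMap ∘ₗ affinePrimitive hT)

/-- The regular solution `u = R (h₀ + ∫ g)` together with its derivative. -/
noncomputable def regularSolution {a : W →L[ℝ] W →L[ℝ] ℝ} (ha : IsCoercive a) (j : W →L[ℝ] H)
    (hT : 0 ≤ T) :
    H × Lp H 2 (timeMeasure T) →ₗ[ℝ] C(Icc 0 T, W) × Lp H 2 (timeMeasure T) :=
  LinearMap.prod
    (((formInverse ha j).compLeftContinuous ℝ (Icc 0 T)).toLinearMap ∘ₗ affinePrimitive hT)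
    (((j.comp (formInverse ha j)).compLpL 2 (timeMeasure T)).toLinearMap ∘ₗ LinearMap.snd ℝ _ _)

section Regular

variable {a : W →L[ℝ] W →L[ℝ] ℝ} (ha : IsCoercive a) (j : W →L[ℝ] H) (hT : 0 ≤ T)
  (p : H × Lp H 2 (timeMeasure T))

lemma regularData_fst : (regularData ha j hT p).fst = formInverse ha j p.1 := rfl

lemma regularData_snd : (regularData ha j hT p).snd =
    (j.comp (formInverse ha j)).compLpL 2 (timeMeasure T) p.2 +
      contToL2 hT (affinePrimitive hT p) := rfl

lemma regularSolution_fst (t : Icc 0 T) : (regularSolution ha j hT p).1 t =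
    formInverse ha j (p.1 + ∫ s in (0 : ℝ)..t, p.2 s) := rfl

lemma regularSolution_snd : (regularSolution ha j hT p).2 =
    (j.comp (formInverse ha j)).compLpL 2 (timeMeasure T) p.2 := rfl

include hT in
/-- The energy estimate for regular solutions. -/
lemma energy_regularSolution (hsym : ∀ v w, a v w = a w v) (t : Icc 0 T) :
    a ((regularSolution ha j hT p).1 t) ((regularSolution ha j hT p).1 t) +
        ∫ s in (0 : ℝ)..t, ‖(regularSolution ha j hT p).2 s‖ ^ 2 ≤
      a (regularData ha j hT p).fst (regularData ha j hT p).fst +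
        ∫ s in (0 : ℝ)..t, ‖(regularData ha j hT p).snd s‖ ^ 2 := by
  have h0 : (0 : ℝ) ∈ Icc 0 T := ⟨le_rfl, hT⟩
  have hg := intervalIntegrable_of_integrable (integrable_coe_Lp p.2) h0 t.2
  obtain ⟨i3, key⟩ := intervalIntegrable_and_bilin_primitive_eq (a.bilinearComp (formInverse ha j) (formInverse ha j)) t.2.1
    hg hg p.1 p.1
  simp only [ContinuousLinearMap.bilinearComp_apply] at key i3
  rw [regularSolution_fst, regularData_fst, key, add_assoc]
  have i1 := intervalIntegrable_of_integrable
    (integrable_norm_sq (Lp.memLp (regularSolution ha j hT p).2)) h0 t.2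
  have i2 := intervalIntegrable_of_integrable
    (integrable_norm_sq (Lp.memLp (regularData ha j hT p).snd)) h0 t.2
  refine add_le_add_right ?_ _
  rw [← le_sub_iff_add_le, ← intervalIntegral.integral_sub i2 i1]
  have hae : ∀ᵐ s ∂timeMeasure T, ∀ hs : s ∈ Icc 0 T,
      (regularData ha j hT p).snd s = j (formInverse ha j (p.2 s)) + affinePrimitive hT p ⟨s, hs⟩ ∧
      (regularSolution ha j hT p).2 s = j (formInverse ha j (p.2 s)) := by
    rw [regularData_snd, regularSolution_snd]
    filter_upwards [Lp.coeFn_add ((j.comp (formInverse ha j)).compLpL 2 (timeMeasure T) p.2)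
      (contToL2 hT (affinePrimitive hT p)), contToL2_ae hT (affinePrimitive hT p),
      (j.comp (formInverse ha j)).coeFn_compLpL (p := 2) (μ := timeMeasure T) p.2] with s h1 h2 h3 hs
    rw [h1, Pi.add_apply, h2 hs, h3]
    exact ⟨rfl, rfl⟩
  have hpt : ∀ᵐ s ∂volume.restrict (Ioc 0 (t : ℝ)),
      a (formInverse ha j (p.2 s)) (formInverse ha j (p.1 + ∫ r in (0 : ℝ)..s, p.2 r)) +
        a (formInverse ha j (p.1 + ∫ r in (0 : ℝ)..s, p.2 r)) (formInverse ha j (p.2 s)) ≤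
      ‖(regularData ha j hT p).snd s‖ ^ 2 - ‖(regularSolution ha j hT p).2 s‖ ^ 2 := by
    filter_upwards [ae_restrict_Ioc_of_ae_timeMeasure hae t.2, ae_restrict_mem measurableSet_Ioc]
      with s hs hsm
    obtain ⟨e1, e2⟩ := hs ⟨hsm.1.le, hsm.2.trans t.2.2⟩
    -- With `p = h₀ + ∫ g`, the data are `u' + p`. The cross term `2 (u', p)` of the square is the
    -- derivative of `a(u, u)`, because `a (R g) (R p) = (p, j R g)`. What is dropped is `‖p‖²`.
    rw [e1, e2, norm_add_sq_real, hsym, formInverse_spec, affinePrimitive_apply, real_inner_comm]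
    nlinarith [sq_nonneg ‖p.1 + ∫ r in (0 : ℝ)..s, p.2 r‖]
  rw [Measure.restrict_congr_set Ioc_ae_eq_Icc] at hpt
  exact intervalIntegral.integral_mono_ae_restrict t.2.1 i3 (i2.sub i1) hpt

lemma inner_contToL2_const (h : H) (G : Lp H 2 (timeMeasure T)) :
    ⟪contToL2 hT (ContinuousMap.const _ h), G⟫ = ⟪h, ∫ s in (0 : ℝ)..T, G s⟫ := by
  rw [← integral_timeMeasure hT, ← integral_inner (integrable_coe_Lp G), L2.inner_def]
  refine integral_congr_ae ?_
  filter_upwards [contToL2_ae hT (ContinuousMap.const _ h), ae_timeMeasure_mem_Ioo T] with s hs hm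
  rw [hs (Ioo_subset_Icc_self hm)]
  rfl

include hT in
/-- The data of regular solutions are dense. -/
lemma denseRange_regularData (hsym : ∀ v w, a v w = a w v) (hj : Function.Injective j) :
    DenseRange (regularData (T := T) ha j hT) := by
  have h : (LinearMap.range (regularData (T := T) ha j hT)).topologicalClosure = ⊤ := by
    rw [Submodule.topologicalClosure_eq_top_iff, Submodule.eq_bot_iff]
    intro x hx
    have hx' : ∀ p, ⟪formInverse ha j p.1, x.fst⟫ +
        ⟪(j.comp (formInverse ha j)).compLpL 2 (timeMeasure T) p.2 +
          contToL2 hT (affinePrimitive hT p), x.snd⟫ = 0 := fun p => by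
      have := (Submodule.mem_orthogonal _ _).1 hx _ (LinearMap.mem_range_self _ p)
      rw [WithLp.prod_inner_apply] at this
      exact this
    -- It suffices that an element orthogonal to all data vanishes. Data with `g = 0` tie its first
    -- component to the mean of `G`; data with `h₀ = 0` give an equation for `G` alone.
    set G := x.snd with hG
    set v' := ha.continuousLinearEquivOfBilin.symm x.fst with hv'
    have hxv : x.fst = ha.continuousLinearEquivOfBilin v' := by simp [hv']
    set m := ∫ s in (0 : ℝ)..T, G s with hm
    have h1 : j v' + m = 0 := by
      refine ext_inner_left ℝ fun h₀ => ?_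
      have := hx' (h₀, 0)
      have e1 : affinePrimitive hT (h₀, (0 : Lp H 2 (timeMeasure T))) =
          ContinuousMap.const _ h₀ := by
        ext t; simp [affinePrimitive]
      simp only [map_zero, zero_add, e1] at this
      rw [inner_contToL2_const, real_inner_comm, hxv, ha.continuousLinearEquivOfBilin_apply, hsym,
        formInverse_spec] at this
      rw [inner_add_right, inner_zero_right]
      exact this
    have h2 : ∀ g : Lp H 2 (timeMeasure T),
        (∫ s, a (formInverse ha j (g s)) (formInverse ha j (G s)) ∂timeMeasure T) +
          ⟪contToL2 hT (primitive hT g), G⟫ = 0 := by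
      intro g
      have := hx' (0, g)
      have e1 : affinePrimitive hT ((0 : H), g) = primitive hT g := by
        ext t; simp [affinePrimitive]
      simp only [map_zero, inner_zero_left, zero_add, e1] at this
      rwa [inner_add_left, inner_compLp_formInverse ha hsym] at this
    -- Testing with `g = G` makes `∫ a (R G) (R G) + ‖m‖² / 2` vanish. Both terms are nonnegative,
    -- so `m = 0` and `R G = 0` almost everywhere; injectivity of `j` then gives `v' = 0`.
    have h3 := inner_contToL2_primitive hT G G
    rw [real_inner_comm, ← two_mul] at h3
    have h4 := h2 G
    rw [real_inner_comm] at h4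
    have hnn : ∀ s, 0 ≤ a (formInverse ha j (G s)) (formInverse ha j (G s)) := fun s => by
      obtain ⟨c, hc, hac⟩ := ha
      exact le_trans (by positivity) (hac _)
    have hnn' := integral_nonneg (μ := timeMeasure T) (f := fun s => a _ _) hnn
    have hmm : ⟪m, m⟫ = 0 := by
      have := real_inner_self_nonneg (x := m)
      linarith
    have hm0 : m = 0 := inner_self_eq_zero.1 hmm
    have hint0 : ∫ s, a (formInverse ha j (G s)) (formInverse ha j (G s)) ∂timeMeasure T = 0 := by
      rw [← hm, hmm] at h3
      linarith
    have hintg : Integrable (fun s => a (formInverse ha j (G s)) (formInverse ha j (G s)))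
        (timeMeasure T) := by
      have := L2.integrable_inner (𝕜 := ℝ)
        ((j.comp (formInverse ha j)).compLpL 2 (timeMeasure T) G) G
      refine this.congr ?_
      filter_upwards [(j.comp (formInverse ha j)).coeFn_compLpL (p := 2) (μ := timeMeasure T) G]
        with s hs
      rw [hs, formInverse_spec, real_inner_comm]
      rfl
    have hR0 : ∀ᵐ s ∂timeMeasure T, formInverse ha j (G s) = 0 := by
      filter_upwards [(integral_eq_zero_iff_of_nonneg hnn hintg).1 hint0] with s hs
      exact IsCoercive.eq_zero_of_apply_self_nonpos ha (le_of_eq hs)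
    have hv0 : v' = 0 := hj (by simpa [hm0] using h1)
    -- With `R G = 0` the equation reduces to orthogonality of `G` to all primitives. Integrating by
    -- parts with `m = 0`, the primitive of `G` is orthogonal to everything.
    have h5 : ∀ g : Lp H 2 (timeMeasure T), ⟪contToL2 hT (primitive hT g), G⟫ = 0 := by
      intro g
      have h6 : ∫ s, a (formInverse ha j (g s)) (formInverse ha j (G s)) ∂timeMeasure T = 0 := by
        rw [← integral_zero ℝ ℝ (μ := timeMeasure T)]
        refine integral_congr_ae ?_
        filter_upwards [hR0] with s hs
        rw [hs, map_zero]
      have := h2 g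
      rwa [h6, zero_add] at this
    have h7 : primitive hT G = 0 := by
      rcases hT.eq_or_lt with h | hpos
      · ext t
        have : (t : ℝ) = 0 := le_antisymm (t.2.2.trans h.symm.le) t.2.1
        simp [primitive_apply, this]
      · refine eq_of_contToL2_eq hpos (u := primitive hT G) (v := 0) ?_
        rw [map_zero]
        refine ext_inner_left ℝ fun g => ?_
        have := inner_contToL2_primitive hT g G
        rw [h5 g, ← hm, hm0, inner_zero_right, zero_add] at this
        rw [this, inner_zero_right]
    have hG0 : x.snd = 0 := eq_zero_of_primitive_eq_zero hT h7
    have hx0 : x.fst = 0 := by rw [hxv, hv0, map_zero]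
    exact WithLp.ofLp_injective 2 (Prod.ext hx0 hG0)
  exact Submodule.dense_iff_topologicalClosure_eq_top.2 h

lemma exists_norm_regularSolution_le (hsym : ∀ v w, a v w = a w v) :
    ∃ C, ∀ p : H × Lp H 2 (timeMeasure T),
      ‖regularSolution ha j hT p‖ ≤ C * ‖regularData ha j hT p‖ := by
  obtain ⟨c, hc, hac⟩ := id ha
  -- The first root bounds the `L²` norm of `u'`, the second the supremum norm of `u`, where the
  -- coercivity constant `c` is divided out.
  refine ⟨√(‖a‖ + 1) + √((‖a‖ + 1) / c), fun p => ?_⟩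
  set d := regularData ha j hT p with hd
  have hdata : ∀ t : Icc 0 T, a d.fst d.fst + ∫ s in (0 : ℝ)..t, ‖d.snd s‖ ^ 2 ≤
      (‖a‖ + 1) * ‖d‖ ^ 2 := by
    intro t
    have e1 : a d.fst d.fst ≤ ‖a‖ * ‖d.fst‖ ^ 2 := by
      refine (Real.le_norm_self _).trans ((a.le_opNorm₂ _ _).trans (by rw [sq, mul_assoc]))
    have e2 : ∫ s in (0 : ℝ)..t, ‖d.snd s‖ ^ 2 ≤ ‖d.snd‖ ^ 2 := by
      rw [norm_sq_eq_integral hT]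
      exact intervalIntegral.integral_mono_interval le_rfl t.2.1 t.2.2
        (ae_of_all _ fun _ => by positivity)
        (intervalIntegrable_of_integrable (integrable_norm_sq (Lp.memLp d.snd)) ⟨le_rfl, hT⟩
          ⟨hT, le_rfl⟩)
    have e3 : ‖d‖ ^ 2 = ‖d.fst‖ ^ 2 + ‖d.snd‖ ^ 2 := WithLp.prod_norm_sq_eq_of_L2 d
    rw [e3]
    nlinarith [norm_nonneg a, sq_nonneg ‖d.fst‖, sq_nonneg ‖d.snd‖,
      mul_nonneg (norm_nonneg a) (sq_nonneg ‖d.snd‖)]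
  have hen := fun t => (energy_regularSolution ha j hT p hsym t).trans (hdata t)
  have hann : ∀ v, 0 ≤ a v v := fun v => le_trans (by positivity) (hac v)
  refine norm_prod_le_iff.2 ⟨?_, ?_⟩
  · refine le_trans ?_ (mul_le_mul_of_nonneg_right
      (le_add_of_nonneg_left (Real.sqrt_nonneg _)) (norm_nonneg d))
    refine (ContinuousMap.norm_le _ (by positivity)).2 fun t => ?_
    refine abs_le_of_sq_le_sq' ?_ (by positivity) |>.2
    rw [mul_pow, Real.sq_sqrt (by positivity), div_mul_eq_mul_div, le_div_iff₀ hc]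
    have h1 := hen t
    have h2 := hac ((regularSolution ha j hT p).1 t)
    have h3 : 0 ≤ ∫ s in (0 : ℝ)..t, ‖(regularSolution ha j hT p).2 s‖ ^ 2 :=
      intervalIntegral.integral_nonneg t.2.1 fun _ _ => by positivity
    nlinarith
  · refine le_trans ?_ (mul_le_mul_of_nonneg_right
      (le_add_of_nonneg_right (Real.sqrt_nonneg _)) (norm_nonneg d))
    refine abs_le_of_sq_le_sq' ?_ (by positivity) |>.2
    rw [mul_pow, Real.sq_sqrt (by positivity), norm_sq_eq_integral hT]
    have h1 := hen ⟨T, hT, le_rfl⟩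
    have h2 := hann ((regularSolution ha j hT p).1 ⟨T, hT, le_rfl⟩)
    exact (le_add_of_nonneg_left h2).trans h1

include ha in
/-- Uniqueness for the linear evolution equation. -/
lemma eq_zero_of_linear_evolution (hT : 0 < T) {z : C(Icc 0 T, W)}
    {w : Lp H 2 (timeMeasure T)} (hz : ∀ t : Icc 0 T, j (z t) = ∫ s in (0 : ℝ)..t, w s)
    (hw : ∀ᵐ s ∂timeMeasure T, ∀ hs : s ∈ Icc 0 T, ∀ v, ⟪w s, j v⟫ + a (z ⟨s, hs⟩) v = 0) :
    z = 0 := by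
  -- The equation reads `z = -R w`. Pairing `w` with its primitive `j z` gives `-∫ a (R w) (R w)` on
  -- one side and half a square on the other, so `R w = 0` and `z = 0`.
  have h1 : ∀ᵐ s ∂timeMeasure T, ∀ hs : s ∈ Icc 0 T, z ⟨s, hs⟩ = - formInverse ha j (w s) := by
    filter_upwards [hw] with s h hs
    rw [← map_neg]
    refine eq_formInverse ha j fun v => ?_
    rw [inner_neg_left]
    linarith [h hs v]
  have h2 := inner_contToL2_primitive hT.le w w
  rw [real_inner_comm, ← two_mul] at h2
  have h3 : ⟪w, contToL2 hT.le (primitive hT.le w)⟫ =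
      - ∫ s, a (formInverse ha j (w s)) (formInverse ha j (w s)) ∂timeMeasure T := by
    rw [L2.inner_def, ← integral_neg]
    refine integral_congr_ae ?_
    filter_upwards [h1, contToL2_ae hT.le (primitive hT.le w), ae_timeMeasure_mem_Ioo T]
      with s e1 e2 hs
    rw [e2 (Ioo_subset_Icc_self hs), primitive_apply, ← hz, e1 (Ioo_subset_Icc_self hs),
      formInverse_spec, map_neg, inner_neg_right]
  have hnn : ∀ s, 0 ≤ a (formInverse ha j (w s)) (formInverse ha j (w s)) := fun s => by
    obtain ⟨c, hc, hac⟩ := ha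
    exact le_trans (by positivity) (hac _)
  have hint0 : ∫ s, a (formInverse ha j (w s)) (formInverse ha j (w s)) ∂timeMeasure T = 0 := by
    have := integral_nonneg (μ := timeMeasure T) (f := fun s => a _ _) hnn
    have := real_inner_self_nonneg (x := ∫ s in (0 : ℝ)..T, w s)
    linarith
  have hintg : Integrable (fun s => a (formInverse ha j (w s)) (formInverse ha j (w s)))
      (timeMeasure T) := by
    have := L2.integrable_inner (𝕜 := ℝ)
      ((j.comp (formInverse ha j)).compLpL 2 (timeMeasure T) w) w
    refine this.congr ?_
    filter_upwards [(j.comp (formInverse ha j)).coeFn_compLpL (p := 2) (μ := timeMeasure T) w]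
      with s hs
    rw [hs, formInverse_spec, real_inner_comm]
    rfl
  refine eq_of_contToL2_eq hT ?_
  rw [map_zero]
  refine Lp.eq_zero_iff_ae_eq_zero.2 ?_
  filter_upwards [(integral_eq_zero_iff_of_nonneg hnn hintg).1 hint0, h1, contToL2_ae hT.le z,
    ae_timeMeasure_mem_Ioo T] with s e1 e2 e3 hs
  rw [e3 (Ioo_subset_Icc_self hs), e2 (Ioo_subset_Icc_self hs),
    IsCoercive.eq_zero_of_apply_self_nonpos ha (le_of_eq e1), neg_zero]
  rfl

end Regular

/-- Solution operator for `w + 𝒜 u = F`, `j u = j u₀ + ∫ w`, with the maximal regularity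
estimate. -/
theorem exists_linear_evolution {a : W →L[ℝ] W →L[ℝ] ℝ} (ha : IsCoercive a)
    (hsym : ∀ v w, a v w = a w v) {j : W →L[ℝ] H} (hj : Function.Injective j) (hT : 0 < T) :
    ∃ (S : WithLp 2 (W × Lp H 2 (timeMeasure T)) →L[ℝ] C(Icc 0 T, W) × Lp H 2 (timeMeasure T))
      (C : ℝ), 0 ≤ C ∧
      (∀ x (t : Icc 0 T), j ((S x).1 t) = j x.fst + ∫ s in (0 : ℝ)..t, (S x).2 s) ∧
      (∀ x, ∀ᵐ s ∂timeMeasure T, ∀ hs : s ∈ Icc 0 T, ∀ v,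
        ⟪(S x).2 s, j v⟫ + a ((S x).1 ⟨s, hs⟩) v = ⟪x.snd s, j v⟫) ∧
      ∀ x (t : Icc 0 T), ‖(S x).1 t‖ ^ 2 ≤
        C * (‖x.fst‖ ^ 2 + ∫ s in (0 : ℝ)..t, ‖x.snd s‖ ^ 2) := by
  have hdense := denseRange_regularData (T := T) ha j hT.le hsym hj
  have hnorm := exists_norm_regularSolution_le (T := T) ha j hT.le hsym
  -- Every claim is a closed condition on `x`, so it need only be checked on the dense set of
  -- regular data.
  set S := (regularSolution (T := T) ha j hT.le).extendOfNorm (regularData ha j hT.le) with hS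
  have hSe : ∀ p, S (regularData ha j hT.le p) = regularSolution ha j hT.le p :=
    fun p => LinearMap.extendOfNorm_eq hdense hnorm p
  have hfst : Continuous fun x : WithLp 2 (W × Lp H 2 (timeMeasure T)) => x.fst :=
    continuous_fst.comp (WithLp.prod_continuous_ofLp 2 _ _)
  have hsnd : Continuous fun x : WithLp 2 (W × Lp H 2 (timeMeasure T)) => x.snd :=
    continuous_snd.comp (WithLp.prod_continuous_ofLp 2 _ _)
  have hev : ∀ t : Icc 0 T, Continuous fun x => (S x).1 t := fun t =>
    (continuous_eval_const t).comp (continuous_fst.comp S.continuous)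
  obtain ⟨c, hc, hac⟩ := id ha
  refine ⟨S, (‖a‖ + 1) / c, by positivity, fun x t => ?_, fun x => ?_, fun x t => ?_⟩
  · change j ((S x).1 t) = j x.fst + primitive hT.le (S x).2 t
    refine hdense.induction_on
      (p := fun x => j ((S x).1 t) = j x.fst + primitive hT.le (S x).2 t) x ?_ ?_
    · refine isClosed_eq (j.continuous.comp (hev t)) ((j.continuous.comp hfst).add ?_)
      exact (continuous_eval_const t).comp
        ((primitive hT.le).continuous.comp (continuous_snd.comp S.continuous))
    · intro p
      have hcomm := (j.comp (formInverse ha j)).intervalIntegral_comp_comm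
        (intervalIntegrable_of_integrable (integrable_coe_Lp p.2) ⟨le_rfl, hT.le⟩ t.2)
      rw [hSe, regularSolution_fst, regularData_fst, regularSolution_snd, map_add, map_add,
        primitive_apply, intervalIntegral_congr_of_ae
          ((j.comp (formInverse ha j)).coeFn_compLpL (p := 2) (μ := timeMeasure T) p.2) t.2, hcomm]
      rfl
  -- The equation tested pointwise almost everywhere is not visibly closed under limits. Applying
  -- `R` turns it into the identity `u = R (F - w)` in `L²`, which is.
  · have key : contToL2 hT.le (S x).1 =
        (formInverse ha j).compLpL 2 (timeMeasure T) (x.snd - (S x).2) := by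
      refine hdense.induction_on (p := fun x => contToL2 hT.le (S x).1 =
        (formInverse ha j).compLpL 2 (timeMeasure T) (x.snd - (S x).2)) x ?_ ?_
      · refine isClosed_eq ((contToL2 hT.le).continuous.comp (continuous_fst.comp S.continuous)) ?_
        exact (ContinuousLinearMap.continuous _).comp
          (hsnd.sub (continuous_snd.comp S.continuous))
      · intro p
        rw [hSe, regularData_snd, regularSolution_snd, add_sub_cancel_left]
        refine Lp.ext ?_
        filter_upwards [contToL2_ae hT.le (regularSolution ha j hT.le p).1,
          contToL2_ae hT.le (affinePrimitive hT.le p), ae_timeMeasure_mem_Ioo T,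
          (formInverse ha j).coeFn_compLpL (p := 2) (μ := timeMeasure T)
            (contToL2 hT.le (affinePrimitive hT.le p))] with s h1 h2 hs h3
        rw [h1 (Ioo_subset_Icc_self hs), h3, h2 (Ioo_subset_Icc_self hs)]
        rfl
    filter_upwards [contToL2_ae hT.le (S x).1, Lp.coeFn_sub x.snd (S x).2,
      (formInverse ha j).coeFn_compLpL (p := 2) (μ := timeMeasure T) (x.snd - (S x).2)]
      with s h1 h2 h3 hs v
    rw [← h1 hs, key, h3, formInverse_spec, h2, Pi.sub_apply, inner_sub_left]
    ring
  · have key : a ((S x).1 t) ((S x).1 t) ≤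
        a x.fst x.fst + ∫ s in (0 : ℝ)..t, ‖x.snd s‖ ^ 2 := by
      refine hdense.induction_on (p := fun x => a ((S x).1 t) ((S x).1 t) ≤
        a x.fst x.fst + ∫ s in (0 : ℝ)..t, ‖x.snd s‖ ^ 2) x ?_ ?_
      · refine isClosed_le ((a.continuous.comp (hev t)).clm_apply (hev t)) ?_
        exact ((a.continuous.comp hfst).clm_apply hfst).add
          ((continuous_integral_norm_sq t.2).comp hsnd)
      · intro p
        rw [hSe]
        refine le_trans ?_ (energy_regularSolution ha j hT.le p hsym t)
        exact le_add_of_nonneg_right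
          (intervalIntegral.integral_nonneg t.2.1 fun _ _ => by positivity)
    have e1 : a x.fst x.fst ≤ ‖a‖ * ‖x.fst‖ ^ 2 := by
      refine (Real.le_norm_self _).trans ((a.le_opNorm₂ _ _).trans (by rw [sq, mul_assoc]))
    have e2 : 0 ≤ ∫ s in (0 : ℝ)..t, ‖x.snd s‖ ^ 2 :=
      intervalIntegral.integral_nonneg t.2.1 fun _ _ => by positivity
    rw [div_mul_eq_mul_div, le_div_iff₀ hc]
    have := hac ((S x).1 t)
    nlinarith [mul_nonneg (norm_nonneg a) e2, sq_nonneg ‖x.fst‖]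

end LinearSolver

/-! ### Fixed points of causal maps on `C([0,T];X)`: uniqueness, continuation, absence of blow-up.
-/

section CausalFixedPoint

open Filter Topology

/-- Real induction: at the supremum of the times where `P` holds, the limit hypothesis gives `P`,
and the step hypothesis forbids stopping before `T`. -/
lemma forall_mem_Icc_of_step_of_limit {T : ℝ} {P : ℝ → Prop} (hT : 0 ≤ T) (h0 : P 0)
    (hmono : ∀ s t, s ≤ t → P t → P s)
    (hstep : ∀ t ∈ Ico 0 T, P t → ∃ t' ∈ Ioc t T, P t')
    (hlim : ∀ t ∈ Ioc 0 T, (∀ s ∈ Ico 0 t, P s) → P t) : P T := by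
  set S := {t | t ∈ Icc 0 T ∧ P t} with hS
  have hne : S.Nonempty := ⟨0, ⟨le_rfl, hT⟩, h0⟩
  have hbdd : BddAbove S := ⟨T, fun t ht => ht.1.2⟩
  set c := sSup S with hc
  have hc0 : 0 ≤ c := le_csSup hbdd ⟨⟨le_rfl, hT⟩, h0⟩
  have hcT : c ≤ T := csSup_le hne fun t ht => ht.1.2
  have hlt : ∀ s ∈ Ico 0 c, P s := fun s hs => by
    obtain ⟨t, ht, hst⟩ := exists_lt_of_lt_csSup hne hs.2
    exact hmono s t hst.le ht.2
  have hPc : P c := by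
    rcases hc0.eq_or_lt with h | h
    · rwa [← h]
    · exact hlim c ⟨h, hcT⟩ hlt
  rcases hcT.eq_or_lt with h | h
  · rwa [← h]
  · obtain ⟨t', ht', hP⟩ := hstep c ⟨hc0, h⟩ hPc
    exact absurd (le_csSup hbdd ⟨⟨hc0.trans ht'.1.le, ht'.2⟩, hP⟩) (not_le.2 ht'.1)

variable {X : Type*} [NormedAddCommGroup X] {T : ℝ}

/-- The function `u` stopped at time `τ`. -/
def stopAt (u : C(Icc 0 T, X)) (τ : Icc 0 T) : C(Icc 0 T, X) :=
  u.comp ⟨fun s => min s τ, by fun_prop⟩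

lemma stopAt_apply (u : C(Icc 0 T, X)) (τ s : Icc 0 T) : stopAt u τ s = u (min s τ) := rfl

lemma stopAt_of_le (u : C(Icc 0 T, X)) {τ s : Icc 0 T} (h : s ≤ τ) : stopAt u τ s = u s := by
  rw [stopAt_apply, min_eq_left h]

lemma stopAt_of_ge (u : C(Icc 0 T, X)) {τ s : Icc 0 T} (h : τ ≤ s) : stopAt u τ s = u τ := by
  rw [stopAt_apply, min_eq_right h]

/-- Locally Lipschitz dependence of a causal map on its argument, with a factor that is small on
short time intervals. -/
def CausalLocallyLipschitz (Φ : C(Icc 0 T, X) → C(Icc 0 T, X)) : Prop :=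
  ∀ x : X, ∃ r : ℝ, 0 < r ∧ ∃ L : ℝ, 0 ≤ L ∧ ∀ (s t : Icc 0 T) (u v : C(Icc 0 T, X)) (D : ℝ),
    s ≤ t → (∀ τ ≤ s, u τ = v τ) →
    (∀ τ, s ≤ τ → τ ≤ t → u τ ∈ Metric.ball x r ∧ v τ ∈ Metric.ball x r ∧ ‖u τ - v τ‖ ≤ D) →
    ‖Φ u t - Φ v t‖ ≤ L * √(t - s) * D

/-- Linear growth of a causal map. -/
def CausalLinearGrowth (Φ : C(Icc 0 T, X) → C(Icc 0 T, X)) (κ : Icc 0 T → ℝ) : Prop :=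
  ∀ (s t : Icc 0 T) (u v : C(Icc 0 T, X)) (M : ℝ), 0 ≤ M → s ≤ t → (∀ τ ≤ s, u τ = v τ) →
    (∀ τ ≤ t, ‖u τ‖ ≤ M ∧ ‖v τ‖ ≤ M) → ‖Φ u t - Φ v t‖ ^ 2 ≤ (κ t - κ s) * (1 + M) ^ 2

variable {Φ : C(Icc 0 T, X) → C(Icc 0 T, X)} {κ : Icc 0 T → ℝ}

/-- Causality is contained in the growth bound: for `s = t` its right-hand side is zero. -/
lemma CausalLinearGrowth.congr (hG : CausalLinearGrowth Φ κ) {t : Icc 0 T} {u v : C(Icc 0 T, X)}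
    (h : ∀ τ ≤ t, u τ = v τ) : Φ u t = Φ v t := by
  have := hG t t u v (max ‖u‖ ‖v‖) (by positivity) le_rfl h fun τ _ =>
    ⟨(u.norm_coe_le_norm τ).trans (le_max_left _ _), (v.norm_coe_le_norm τ).trans (le_max_right _ _)⟩
  rw [sub_self, zero_mul] at this
  have h2 : ‖Φ u t - Φ v t‖ = 0 := by
    have := norm_nonneg (Φ u t - Φ v t)
    nlinarith
  exact sub_eq_zero.1 (norm_eq_zero.1 h2)

lemma exists_short_time {L : ℝ} {t₀ b : ℝ} (h : t₀ < b) (δ : ℝ) (hδ : 0 < δ) :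
    ∃ t₁ ∈ Ioc t₀ b, t₁ < t₀ + δ ∧ L * √(t₁ - t₀) ≤ 1 / 2 := by
  have hc : Tendsto (fun t => L * √(t - t₀)) (𝓝[>] t₀) (𝓝 0) := by
    have : Continuous fun t => L * √(t - t₀) := by fun_prop
    have h1 := this.tendsto t₀
    simp only [sub_self, Real.sqrt_zero, mul_zero] at h1
    exact h1.mono_left nhdsWithin_le_nhds
  have h1 : ∀ᶠ t in 𝓝[>] t₀, L * √(t - t₀) < 1 / 2 := hc.eventually (gt_mem_nhds (by norm_num))
  have h2 : ∀ᶠ t in 𝓝[>] t₀, t ∈ Ioc t₀ b := Ioc_mem_nhdsGT h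
  have h3 : ∀ᶠ t in 𝓝[>] t₀, t ∈ Ioo t₀ (t₀ + δ) := Ioo_mem_nhdsGT (by linarith)
  obtain ⟨t, a1, a2, a3⟩ := (h1.and (h2.and h3)).exists
  exact ⟨t, a2, a3.2, a1.le⟩

lemma eq_of_forall_lt_eq {u v : C(Icc 0 T, X)} {t : Icc 0 T} (ht : 0 < (t : ℝ))
    (h : ∀ s < t, u s = v s) : u t = v t := by
  by_contra hne
  have hopen : IsOpen {s | u s ≠ v s} := isOpen_ne_fun u.continuous v.continuous
  obtain ⟨δ, hδ, hball⟩ := Metric.isOpen_iff.1 hopen t hne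
  have hm : max 0 ((t : ℝ) - δ / 2) ∈ Icc 0 T :=
    ⟨le_max_left _ _, max_le (t.2.1.trans t.2.2) (by linarith [t.2.2])⟩
  have hlt : max 0 ((t : ℝ) - δ / 2) < t := max_lt ht (by linarith)
  refine hball (a := ⟨_, hm⟩) ?_ (h ⟨_, hm⟩ hlt)
  rw [Metric.mem_ball, Subtype.dist_eq, Real.dist_eq, abs_sub_comm, abs_of_pos (by linarith)]
  have := le_max_right 0 ((t : ℝ) - δ / 2)
  simp only
  linarith

/-- Two solutions of `Φ u = u` up to time `b` agree up to time `b`. -/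
lemma CausalLocallyLipschitz.eq_of_isFixedPt_upto (hL : CausalLocallyLipschitz Φ) {x₀ : X}
    (hT : 0 ≤ T) (hI : ∀ u, Φ u ⟨0, le_rfl, hT⟩ = x₀) {b : Icc 0 T} {u v : C(Icc 0 T, X)}
    (hu : ∀ s ≤ b, Φ u s = u s) (hv : ∀ s ≤ b, Φ v s = v s) : ∀ s ≤ b, u s = v s := by
  suffices h : ∀ s : Icc 0 T, (s : ℝ) ≤ b → u s = v s from h
  refine forall_mem_Icc_of_step_of_limit (T := b) (P := fun t => ∀ s : Icc 0 T, (s : ℝ) ≤ t →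
    u s = v s) b.2.1 ?_ (fun s t hst h r hr => h r (hr.trans hst)) ?_ ?_
  · intro s hs
    have : s = ⟨0, le_rfl, hT⟩ := Subtype.ext (le_antisymm hs s.2.1)
    have hb : (⟨0, le_rfl, hT⟩ : Icc 0 T) ≤ b := b.2.1
    rw [this, ← hu _ hb, ← hv _ hb, hI, hI]
  · intro t ht hP
    have htm : t ∈ Icc 0 T := ⟨ht.1, ht.2.le.trans b.2.2⟩
    set t₀ : Icc 0 T := ⟨t, htm⟩ with ht₀
    obtain ⟨r, hr, L, hL0, H⟩ := hL (u t₀)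
    have hev : ∀ᶠ s in 𝓝 t₀, u s ∈ Metric.ball (u t₀) r ∧ v s ∈ Metric.ball (u t₀) r := by
      refine (u.continuous.continuousAt.eventually (Metric.ball_mem_nhds _ hr)).and ?_
      rw [hP t₀ le_rfl]
      exact v.continuous.continuousAt.eventually (Metric.ball_mem_nhds _ hr)
    obtain ⟨δ, hδ, hball⟩ := Metric.eventually_nhds_iff.1 hev
    obtain ⟨t₁, ht₁, hδ₁, hLt⟩ := exists_short_time (L := L) ht.2 δ hδ
    have hm1 : t₁ ∈ Icc 0 T := ⟨ht.1.trans ht₁.1.le, ht₁.2.trans b.2.2⟩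
    set τ₁ : Icc 0 T := ⟨t₁, hm1⟩ with hτ₁
    -- `D` is the largest distance of the two solutions up to `t₁`. As they agree up to `t₀`, the
    -- Lipschitz estimate on the short interval gives `D ≤ D / 2`.
    set D := ‖stopAt u τ₁ - stopAt v τ₁‖ with hD
    have hDle : ∀ s ≤ τ₁, ‖u s - v s‖ ≤ D := fun s hs => by
      have := (stopAt u τ₁ - stopAt v τ₁).norm_coe_le_norm s
      rwa [ContinuousMap.sub_apply, stopAt_of_le _ hs, stopAt_of_le _ hs] at this
    have hhalf : ∀ s ≤ τ₁, ‖u s - v s‖ ≤ 1 / 2 * D := by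
      intro s hs
      have hD0 : 0 ≤ D := norm_nonneg _
      rcases le_total s t₀ with h | h
      · rw [hP s h, sub_self, norm_zero]; positivity
      · have hsb : s ≤ b := le_trans hs ht₁.2
        rw [← hu s hsb, ← hv s hsb]
        refine (H t₀ s u v D h (fun τ hτ => hP τ hτ) fun τ h1 h2 => ?_).trans ?_
        · have hd : dist τ t₀ < δ := by
            have e1 : t ≤ (τ : ℝ) := h1
            have e2 : (τ : ℝ) ≤ t₁ := h2.trans hs
            rw [Subtype.dist_eq, Real.dist_eq, abs_of_nonneg (sub_nonneg.2 (Subtype.coe_le_coe.2 h1))]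
            change (τ : ℝ) - t < δ
            linarith
          exact ⟨(hball hd).1, (hball hd).2, hDle τ (h2.trans hs)⟩
        · gcongr
          refine le_trans ?_ hLt
          have e : (s : ℝ) ≤ t₁ := hs
          gcongr
    have hDD : D ≤ 1 / 2 * D := by
      refine (ContinuousMap.norm_le _ (by positivity)).2 fun s => ?_
      exact hhalf _ (min_le_right _ _)
    have hD0 : D = 0 := le_antisymm (by linarith) (norm_nonneg _)
    refine ⟨t₁, ht₁, fun s hs => ?_⟩
    have := hDle s hs
    rw [hD0] at this
    exact sub_eq_zero.1 (norm_le_zero_iff.1 this)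
  · intro t ht hP s hs
    have hm : t ∈ Icc 0 T := ⟨ht.1.le, ht.2.trans b.2.2⟩
    rcases hs.eq_or_lt with h | h
    · have hst : s = ⟨t, hm⟩ := Subtype.ext h
      rw [hst]
      exact eq_of_forall_lt_eq ht.1 fun r hr => hP r ⟨r.2.1, hr⟩ r le_rfl
    · exact hP s ⟨s.2.1, h⟩ s le_rfl

/-- A solution up to time `t < T` can be continued. -/
lemma exists_isFixedPt_upto_step [CompleteSpace X] (hL : CausalLocallyLipschitz Φ)
    (hG : CausalLinearGrowth Φ κ) {t₀ : Icc 0 T} (ht₀ : (t₀ : ℝ) < T) {u : C(Icc 0 T, X)}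
    (hu : ∀ s ≤ t₀, Φ u s = u s) :
    ∃ t₁ : Icc 0 T, t₀ < t₁ ∧ ∃ w, ∀ s ≤ t₁, Φ w s = w s := by
  obtain ⟨r, hr, L, hL0, H⟩ := hL (u t₀)
  set ub := stopAt u t₀ with hub
  have hΦub : Φ ub t₀ = u t₀ := by
    rw [← hu t₀ le_rfl]
    exact hG.congr fun τ hτ => stopAt_of_le _ hτ
  have hev : ∀ᶠ s in 𝓝 t₀, Φ ub s ∈ Metric.ball (u t₀) (r / 4) := by
    refine (Φ ub).continuous.continuousAt.eventually ?_
    rw [hΦub]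
    exact Metric.ball_mem_nhds _ (by positivity)
  obtain ⟨δ, hδ, hball⟩ := Metric.eventually_nhds_iff.1 hev
  obtain ⟨t₁, ht₁, hδ₁, hLt⟩ := exists_short_time (L := L) ht₀ δ hδ
  set τ₁ : Icc 0 T := ⟨t₁, t₀.2.1.trans ht₁.1.le, ht₁.2⟩ with hτ₁
  have h01 : t₀ < τ₁ := ht₁.1
  -- Contraction on continuations of `u` staying within `r / 2` of `u t₀`. Invariance splits as `r /
  -- 4 + r / 4`: half the distance to the constant continuation `ub`, plus the drift of `Φ ub`.
  -- Stopping at `τ₁` lets the map act on functions on all of `[0, T]`.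
  set S : Set C(Icc 0 T, X) :=
    {w | (∀ s ≤ t₀, w s = u s) ∧ ∀ s, t₀ ≤ s → ‖w s - u t₀‖ ≤ r / 2} with hS
  have hclosed : IsClosed S := by
    simp only [hS, ofPred_and, ofPred_forall]
    refine IsClosed.inter (isClosed_iInter fun s => isClosed_iInter fun _ => ?_)
      (isClosed_iInter fun s => isClosed_iInter fun _ => ?_)
    · exact isClosed_eq (continuous_eval_const s) continuous_const
    · exact isClosed_le ((continuous_eval_const s).sub continuous_const).norm continuous_const
  have hball' : ∀ w ∈ S, ∀ s, t₀ ≤ s → w s ∈ Metric.ball (u t₀) r := fun w hw s hs => by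
    rw [mem_ball_iff_norm]
    exact (hw.2 s hs).trans_lt (by linarith)
  have hest : ∀ w ∈ S, ∀ w' ∈ S, ∀ D, (∀ s, t₀ ≤ s → ‖w s - w' s‖ ≤ D) → 0 ≤ D →
      ∀ s, t₀ ≤ s → s ≤ τ₁ → ‖Φ w s - Φ w' s‖ ≤ 1 / 2 * D := by
    intro w hw w' hw' D hD hD0 s hs hs1
    refine (H t₀ s w w' D hs (fun τ hτ => (hw.1 τ hτ).trans (hw'.1 τ hτ).symm)
      fun τ h1 _ => ⟨hball' w hw τ h1, hball' w' hw' τ h1, hD τ h1⟩).trans ?_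
    gcongr
    refine le_trans ?_ hLt
    have e : (s : ℝ) ≤ t₁ := hs1
    gcongr
  have hubS : ub ∈ S := by
    refine ⟨fun s hs => stopAt_of_le _ hs, fun s hs => ?_⟩
    rw [hub, stopAt_of_ge _ hs, sub_self, norm_zero]
    positivity
  have hmaps : MapsTo (fun w => stopAt (Φ w) τ₁) S S := by
    intro w hw
    refine ⟨fun s hs => ?_, fun s hs => ?_⟩
    · rw [stopAt_of_le _ (hs.trans h01.le), ← hu s hs]
      exact hG.congr fun τ hτ => hw.1 τ (hτ.trans hs)
    · rw [stopAt_apply]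
      set σ := min s τ₁ with hσ
      have h1 : t₀ ≤ σ := le_min hs h01.le
      have h2 : σ ≤ τ₁ := min_le_right _ _
      have e1 := hest w hw ub hubS (r / 2) (fun s hs => by
        rw [hub, stopAt_of_ge _ hs]; exact hw.2 s hs) (by positivity) σ h1 h2
      have hd : dist σ t₀ < δ := by
        rw [Subtype.dist_eq, Real.dist_eq, abs_of_nonneg (sub_nonneg.2 (Subtype.coe_le_coe.2 h1))]
        have e2 : (σ : ℝ) ≤ t₁ := h2
        linarith
      have e3 := mem_ball_iff_norm.1 (hball hd)
      calc ‖Φ w σ - u t₀‖ = ‖(Φ w σ - Φ ub σ) + (Φ ub σ - u t₀)‖ := by abel_nf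
        _ ≤ _ := norm_add_le _ _
        _ ≤ r / 2 := by linarith
  have hcontr : ContractingWith (1 / 2) (hmaps.restrict (fun w => stopAt (Φ w) τ₁) S S) := by
    refine ⟨by norm_num [← NNReal.coe_lt_coe], LipschitzWith.of_dist_le_mul fun w w' => ?_⟩
    rw [Subtype.dist_eq, Subtype.dist_eq, dist_eq_norm, dist_eq_norm]
    refine (ContinuousMap.norm_le _ (by positivity)).2 fun s => ?_
    change ‖Φ w (min s τ₁) - Φ w' (min s τ₁)‖ ≤ _
    rcases le_total t₀ s with h | h
    · have := hest w w.2 w' w'.2 ‖(w : C(Icc 0 T, X)) - w'‖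
        (fun s _ => ContinuousMap.norm_coe_le_norm ((w : C(Icc 0 T, X)) - (w' : C(Icc 0 T, X))) s) (norm_nonneg _) (min s τ₁)
        (le_min h h01.le) (min_le_right _ _)
      simpa using this
    · rw [hG.congr (u := w) (v := w') (t := min s τ₁) fun τ hτ => ?_, sub_self, norm_zero]
      · positivity
      · have hτ' : τ ≤ t₀ := hτ.trans ((min_le_left _ _).trans h)
        rw [w.2.1 τ hτ', w'.2.1 τ hτ']
  obtain ⟨w, hwS, hw, -⟩ := ContractingWith.exists_fixedPoint' hclosed.isComplete hmaps hcontr hubS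
    (edist_ne_top _ _)
  refine ⟨τ₁, h01, w, fun s hs => ?_⟩
  have := DFunLike.congr_fun hw s
  rwa [stopAt_of_le _ hs] at this

/-- If there are solutions up to all times `s < t`, then there is one up to time `t`. -/
lemma exists_isFixedPt_upto_limit [CompleteSpace X] (hL : CausalLocallyLipschitz Φ)
    (hG : CausalLinearGrowth Φ κ) (hκ : Continuous κ) {x₀ : X}
    (hT : 0 ≤ T) (hI : ∀ u, Φ u ⟨0, le_rfl, hT⟩ = x₀) {t : Icc 0 T} (ht : 0 < (t : ℝ))
    (h : ∀ s < t, ∃ u, ∀ τ ≤ s, Φ u τ = u τ) : ∃ u, ∀ τ ≤ t, Φ u τ = u τ := by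
  choose! U hU using h
  -- The solutions up to `s`, frozen from `s` on. By uniqueness they are compatible, and freezing
  -- makes their supremum norm depend only on `[0, s]`.
  set V : Icc 0 T → C(Icc 0 T, X) := fun s => stopAt (U s) s with hV
  have hVfix : ∀ s < t, ∀ τ ≤ s, Φ (V s) τ = V s τ := fun s hs τ hτ => by
    rw [hV, stopAt_of_le _ hτ, ← hU s hs τ hτ]
    exact hG.congr fun σ hσ => stopAt_of_le _ (hσ.trans hτ)
  have hcoh : ∀ s s', s ≤ s' → s' < t → ∀ τ ≤ s, V s τ = V s' τ := fun s s' hss hs' =>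
    hL.eq_of_isFixedPt_upto hT hI (hVfix s (hss.trans_lt hs'))
      fun τ hτ => hVfix s' hs' τ (hτ.trans hss)
  have hκt : ∀ η > 0, ∃ σ < t, ∀ τ, σ ≤ τ → τ ≤ t → |κ τ - κ t| ≤ η := by
    intro η hη
    obtain ⟨δ, hδ, hball⟩ := Metric.continuous_iff.1 hκ t η hη
    have hm : max 0 ((t : ℝ) - δ / 2) ∈ Icc 0 T :=
      ⟨le_max_left _ _, max_le hT (by linarith [t.2.2])⟩
    refine ⟨⟨_, hm⟩, max_lt ht (by linarith), fun τ h1 h2 => ?_⟩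
    have h1' : max 0 ((t : ℝ) - δ / 2) ≤ τ := h1
    have h2' : (τ : ℝ) ≤ t := h2
    refine (hball τ ?_).le
    rw [Subtype.dist_eq, Real.dist_eq, abs_sub_comm, abs_of_nonneg (by linarith)]
    linarith [le_max_right 0 ((t : ℝ) - δ / 2)]
  obtain ⟨M, hM0, σ, hσt, hM⟩ : ∃ M, 0 ≤ M ∧ ∃ σ < t, ∀ s, σ ≤ s → s < t → ‖V s‖ ≤ M := by
    -- On `[σ, t)` the increments of `κ` are then at most `1 / 16`, so growth contributes at most a
    -- quarter of `1 + m + M₀`, and `m` can be absorbed on the left. This is the a priori bound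
    -- against blow-up.
    obtain ⟨σ, hσ, hη⟩ := hκt (1 / 32) (by norm_num)
    set M₀ := ‖V σ‖
    set M₁ := ‖Φ (V σ)‖
    have h0 : 0 ≤ M₀ := norm_nonneg _
    have h1 : 0 ≤ M₁ := norm_nonneg _
    refine ⟨2 * (M₀ + M₁ + (1 + M₀)), by positivity, σ, hσ, fun s hs hst => ?_⟩
    set m := ‖V s‖
    have hm : 0 ≤ m := norm_nonneg _
    have key : m ≤ M₀ + M₁ + 1 / 4 * (1 + (m + M₀)) := by
      refine (ContinuousMap.norm_le _ (by positivity)).2 fun τ => ?_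
      have hτ : V s τ = V s (min τ s) := by
        simp only [hV, stopAt_apply, min_assoc, min_self]
      rw [hτ]
      set ρ := min τ s
      have hρ : ρ ≤ s := min_le_right _ _
      rcases le_total ρ σ with h | h
      · rw [← hcoh σ s hs hst ρ h]
        have := (V σ).norm_coe_le_norm ρ
        have : 0 ≤ 1 / 4 * (1 + (m + M₀)) := by positivity
        linarith
      · rw [← hVfix s hst ρ hρ]
        have e1 := hG σ ρ (V s) (V σ) (m + M₀) (by positivity) h
          (fun τ hτ => (hcoh σ s hs hst τ hτ).symm) fun τ _ =>
            ⟨((V s).norm_coe_le_norm τ).trans (by linarith),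
              ((V σ).norm_coe_le_norm τ).trans (by linarith)⟩
        have e2 : κ ρ - κ σ ≤ 1 / 16 := by
          have a1 := abs_le.1 (hη ρ h (hρ.trans hst.le))
          have a2 := abs_le.1 (hη σ le_rfl hσ.le)
          linarith
        have e3 : ‖Φ (V s) ρ - Φ (V σ) ρ‖ ≤ 1 / 4 * (1 + (m + M₀)) := by
          refine abs_le_of_sq_le_sq' ?_ (by positivity) |>.2
          nlinarith [sq_nonneg (1 + (m + M₀))]
        have e4 : ‖Φ (V s) ρ‖ ≤ ‖Φ (V s) ρ - Φ (V σ) ρ‖ + ‖Φ (V σ) ρ‖ := by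
          simpa using norm_add_le (Φ (V s) ρ - Φ (V σ) ρ) (Φ (V σ) ρ)
        have e5 := (Φ (V σ)).norm_coe_le_norm ρ
        linarith
    linarith
  obtain ⟨a, hamono, ha, hat⟩ := exists_seq_strictMono_tendsto' (show (σ : ℝ) < t from hσt)
  have ham : ∀ n, a n ∈ Icc 0 T := fun n =>
    ⟨σ.2.1.trans (ha n).1.le, (ha n).2.le.trans t.2.2⟩
  set s : ℕ → Icc 0 T := fun n => ⟨a n, ham n⟩ with hs
  have hsσ : ∀ n, σ ≤ s n := fun n => (ha n).1.le
  have hst : ∀ n, s n < t := fun n => (ha n).2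
  have hge : ∀ τ < t, ∃ N, ∀ n ≥ N, τ ≤ s n := fun τ hτ =>
    eventually_atTop.1 ((hat.eventually (lt_mem_nhds (show (τ : ℝ) < t from hτ))).mono
      fun n hn => le_of_lt hn)
  -- Applying `Φ` makes the growth estimate available beyond `s n`, where the frozen function no
  -- longer solves anything: two members agree up to the earlier time and then differ by little,
  -- since `κ` varies little near `t`.
  set y : ℕ → C(Icc 0 T, X) := fun n => stopAt (Φ (V (s n))) t with hy
  have hcauchy : CauchySeq y := by
    refine Metric.cauchySeq_iff'.2 fun ε hε => ?_
    obtain ⟨σ', hσ', hη⟩ := hκt (ε ^ 2 / (8 * (1 + M) ^ 2)) (by positivity)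
    obtain ⟨N, hN⟩ := hge σ' hσ'
    refine ⟨N, fun n hn => ?_⟩
    rw [dist_eq_norm]
    refine lt_of_le_of_lt (b := ε / 2) ?_ (by linarith)
    have aux : ∀ k l, N ≤ k → s k ≤ s l → ‖y l - y k‖ ≤ ε / 2 := by
      intro k l hk hkl
      refine (ContinuousMap.norm_le _ (by positivity)).2 fun τ => ?_
      rw [ContinuousMap.sub_apply, hy, stopAt_apply, stopAt_apply]
      set ρ := min τ t
      have hρ : ρ ≤ t := min_le_right _ _
      have hag : ∀ τ ≤ s k, V (s l) τ = V (s k) τ := fun τ hτ =>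
        (hcoh (s k) (s l) hkl (hst l) τ hτ).symm
      rcases le_total ρ (s k) with h | h
      · rw [hG.congr fun τ hτ => hag τ (hτ.trans h), sub_self, norm_zero]
        positivity
      · have e1 := hG (s k) ρ (V (s l)) (V (s k)) M hM0 h hag fun τ _ =>
          ⟨((V (s l)).norm_coe_le_norm τ).trans (hM _ (hsσ l) (hst l)),
            ((V (s k)).norm_coe_le_norm τ).trans (hM _ (hsσ k) (hst k))⟩
        have a1 := abs_le.1 (hη ρ ((hN k hk).trans h) hρ)
        have a2 := abs_le.1 (hη (s k) (hN k hk) (hst k).le)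
        have e2 : κ ρ - κ (s k) ≤ 2 * (ε ^ 2 / (8 * (1 + M) ^ 2)) := by linarith
        refine abs_le_of_sq_le_sq' ?_ (by positivity) |>.2
        refine e1.trans ((mul_le_mul_of_nonneg_right e2 (sq_nonneg _)).trans (le_of_eq ?_))
        field_simp
        norm_num
    exact aux N n le_rfl (hamono.monotone hn)
  obtain ⟨u, hu⟩ := cauchySeq_tendsto_of_complete hcauchy
  have huV : ∀ n, ∀ τ ≤ s n, u τ = V (s n) τ := by
    intro n τ hτ
    have h1 : Tendsto (fun m => y m τ) atTop (𝓝 (u τ)) :=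
      ((continuous_eval_const τ).tendsto u).comp hu
    refine tendsto_nhds_unique h1 (tendsto_const_nhds.congr' ?_)
    filter_upwards [eventually_ge_atTop n] with m hm
    have hnm : s n ≤ s m := hamono.monotone hm
    rw [hy, stopAt_of_le _ (hτ.trans (hst n).le), hVfix (s m) (hst m) τ (hτ.trans hnm)]
    exact hcoh _ _ hnm (hst m) τ hτ
  have hlt : ∀ τ < t, Φ u τ = u τ := by
    intro τ hτ
    obtain ⟨N, hN⟩ := hge τ hτ
    have hτN := hN N le_rfl
    rw [huV N τ hτN, ← hVfix (s N) (hst N) τ hτN]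
    exact hG.congr fun r hr => huV N r (hr.trans hτN)
  refine ⟨u, fun τ hτ => ?_⟩
  rcases hτ.eq_or_lt with h | h
  · rw [h]
    exact eq_of_forall_lt_eq ht hlt
  · exact hlt τ h

/-- A causal map that is locally Lipschitz and of linear growth has a unique fixed point. -/
theorem existsUnique_fixedPoint_of_causal [CompleteSpace X] (hL : CausalLocallyLipschitz Φ)
    (hG : CausalLinearGrowth Φ κ) (hκ : Continuous κ) {x₀ : X}
    (hT : 0 ≤ T) (hI : ∀ u, Φ u ⟨0, le_rfl, hT⟩ = x₀) : ∃! u, Φ u = u := by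
  have hle : ∀ s : Icc 0 T, s ≤ ⟨T, hT, le_rfl⟩ := fun s => s.2.2
  have hex : ∃ u, ∀ s : Icc 0 T, (s : ℝ) ≤ T → Φ u s = u s := by
    refine forall_mem_Icc_of_step_of_limit
      (P := fun t => ∃ u, ∀ s : Icc 0 T, (s : ℝ) ≤ t → Φ u s = u s) hT ?_ ?_ ?_ ?_
    · refine ⟨ContinuousMap.const _ x₀, fun s hs => ?_⟩
      have : s = ⟨0, le_rfl, hT⟩ := Subtype.ext (le_antisymm hs s.2.1)
      rw [this, hI]
      rfl
    · rintro s t hst ⟨u, hu⟩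
      exact ⟨u, fun r hr => hu r (hr.trans hst)⟩
    · rintro t ht ⟨u, hu⟩
      obtain ⟨t₁, h1, w, hw⟩ := exists_isFixedPt_upto_step hL hG (t₀ := ⟨t, ht.1, ht.2.le⟩) ht.2 hu
      exact ⟨t₁, ⟨h1, t₁.2.2⟩, w, hw⟩
    · intro t ht h
      exact exists_isFixedPt_upto_limit hL hG hκ hT hI (t := ⟨t, ht.1.le, ht.2⟩) ht.1
        fun s hs => h s ⟨s.2.1, hs⟩
  obtain ⟨u, hu⟩ := hex
  refine ⟨u, ContinuousMap.ext fun s => hu s s.2.2, fun v hv => ContinuousMap.ext fun s => ?_⟩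
  exact hL.eq_of_isFixedPt_upto hT hI (b := ⟨T, hT, le_rfl⟩)
    (fun s _ => DFunLike.congr_fun hv s) (fun s _ => hu s s.2.2) s (hle s)

end CausalFixedPoint

/-! ### Superposition with a Carathéodory function. -/

section Nemytskii

open Filter Topology

variable {V H : Type*} [NormedAddCommGroup V] [InnerProductSpace ℝ V]
  [NormedAddCommGroup H] [InnerProductSpace ℝ H] {T : ℝ} {f : ℝ → V → H}

lemma tendsto_floor_grid (t : ℝ) :
    Tendsto (fun n : ℕ => (⌊((n : ℝ) + 1) * t⌋ : ℝ) / ((n : ℝ) + 1)) atTop (𝓝 t) := by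
  refine tendsto_iff_dist_tendsto_zero.2 ?_
  refine squeeze_zero (fun _ => dist_nonneg) (fun n => ?_) tendsto_one_div_add_atTop_nhds_zero_nat
  have hn : (0 : ℝ) < n + 1 := by positivity
  have h1 := Int.floor_le (((n : ℝ) + 1) * t)
  have h2 := Int.lt_floor_add_one (((n : ℝ) + 1) * t)
  have e : (⌊((n : ℝ) + 1) * t⌋ : ℝ) / (n + 1) - t = (⌊((n : ℝ) + 1) * t⌋ - (n + 1) * t) / (n + 1) := by
    field_simp
  rw [Real.dist_eq, e, abs_div, abs_of_pos hn]
  gcongr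
  rw [abs_le]
  constructor <;> linarith

/-- Sampling `u` at the grid points `⌊(n+1)t⌋/(n+1)` uses only countably many states, so
measurability for each fixed state suffices; continuity in the state gives the limit. -/
lemma Caratheodory.aestronglyMeasurable_comp (hf : Caratheodory T f) {u : ℝ → V}
    (hu : Continuous u) : AEStronglyMeasurable (fun t => f t (u t)) (timeMeasure T) := by
  refine aestronglyMeasurable_of_tendsto_ae atTop
    (f := fun (n : ℕ) t => f t (u ((⌊((n : ℝ) + 1) * t⌋ : ℝ) / ((n : ℝ) + 1)))) (fun n => ?_) ?_
  · have hmeas : ∀ k : ℤ, MeasurableSet {t : ℝ | ⌊((n : ℝ) + 1) * t⌋ = k} := fun k =>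
      (Int.measurable_floor.comp (measurable_const_mul _)) (measurableSet_singleton k)
    have hU : (⋃ k : ℤ, {t : ℝ | ⌊((n : ℝ) + 1) * t⌋ = k}) = univ := by
      ext t; simp
    rw [← Measure.restrict_univ (μ := timeMeasure T), ← hU, aestronglyMeasurable_iUnion_iff]
    intro k
    refine ((hf.measurable (u (k / ((n : ℝ) + 1)))).mono_measure Measure.restrict_le_self).congr ?_
    filter_upwards [ae_restrict_mem (hmeas k)] with t ht
    have ht' : ⌊((n : ℝ) + 1) * t⌋ = k := ht
    rw [ht']
  · filter_upwards [hf.continuous] with t ht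
    exact (ht.tendsto _).comp ((hu.tendsto t).comp (tendsto_floor_grid t))

/-- The exceptional null set in the growth bound depends on the state. The countably many grid
states share one null set, and continuity extends the bound to `u t`. -/
lemma Caratheodory.ae_norm_comp_le (hf : Caratheodory T f) {k : ℝ → ℝ}
    (hk : ∀ v : V, ∀ᵐ t ∂timeMeasure T, ‖f t v‖ ≤ k t * (1 + ‖v‖)) {u : ℝ → V}
    (hu : Continuous u) : ∀ᵐ t ∂timeMeasure T, ‖f t (u t)‖ ≤ k t * (1 + ‖u t‖) := by
  have h : ∀ᵐ t ∂timeMeasure T, ∀ (n : ℕ) (m : ℤ),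
      ‖f t (u ((m : ℝ) / ((n : ℝ) + 1)))‖ ≤ k t * (1 + ‖u ((m : ℝ) / ((n : ℝ) + 1))‖) :=
    ae_all_iff.2 fun n => ae_all_iff.2 fun m => hk _
  filter_upwards [h, hf.continuous] with t ht hc
  have hlim := (hu.tendsto t).comp (tendsto_floor_grid t)
  refine le_of_tendsto_of_tendsto' ((hc.tendsto _).comp hlim).norm
    ((hlim.norm.const_add 1).const_mul (k t)) fun n => ht n _

lemma Caratheodory.memL2_comp (hf : Caratheodory T f) (hg : LinearGrowth T f) {u : ℝ → V}
    (hu : Continuous u) : MemL2 T (fun t => f t (u t)) := by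
  obtain ⟨k, hk, hkf⟩ := hg
  obtain ⟨C, hC⟩ := (isCompact_Icc (a := (0 : ℝ)) (b := T)).exists_bound_of_continuousOn
    hu.continuousOn
  refine MemLp.of_le (hk.const_mul (1 + C)) (hf.aestronglyMeasurable_comp hu) ?_
  filter_upwards [hf.ae_norm_comp_le hkf hu, ae_timeMeasure_mem_Ioo T] with t ht hm
  have h1 := hC t (Ioo_subset_Icc_self hm)
  have h2 := norm_nonneg (u t)
  have h3 : 0 ≤ k t := by
    by_contra! h
    have := norm_nonneg (f t (u t))
    nlinarith
  rw [Real.norm_eq_abs, abs_mul, abs_of_nonneg (by linarith : (0 : ℝ) ≤ 1 + C), abs_of_nonneg h3]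
  nlinarith

lemma Caratheodory.add_clm (hf : Caratheodory T f) (D : V →L[ℝ] H) :
    Caratheodory T (fun t v => f t v + D v) where
  continuous := by
    filter_upwards [hf.continuous] with t ht
    exact ht.add D.continuous
  measurable v := (hf.measurable v).add aestronglyMeasurable_const

lemma LinearGrowth.add_clm (hf : LinearGrowth T f) (D : V →L[ℝ] H) :
    LinearGrowth T (fun t v => f t v + D v) := by
  obtain ⟨k, hk, hkf⟩ := hf
  refine ⟨fun t => k t + ‖D‖, MemLp.add hk (memLp_const _), fun v => ?_⟩
  filter_upwards [hkf v] with t ht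
  have h1 := D.le_opNorm v
  have h2 := norm_add_le (f t v) (D v)
  have h3 := norm_nonneg D
  linarith

lemma LocallyLipschitzInState.add_clm (hf : LocallyLipschitzInState T f) (D : V →L[ℝ] H) :
    LocallyLipschitzInState T (fun t v => f t v + D v) := by
  intro v
  obtain ⟨r, hr, L, hL, h⟩ := hf v
  refine ⟨r, hr, L + ‖D‖, by positivity, ?_⟩
  filter_upwards [h] with t ht v₁ h₁ v₂ h₂
  have e1 := ht v₁ h₁ v₂ h₂
  have e2 := D.le_opNorm (v₁ - v₂)
  rw [map_sub] at e2
  have e3 : f t v₁ + D v₁ - (f t v₂ + D v₂) = (f t v₁ - f t v₂) + (D v₁ - D v₂) := by abel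
  rw [e3]
  have := norm_add_le (f t v₁ - f t v₂) (D v₁ - D v₂)
  linarith

end Nemytskii

/-! ### Weak derivatives and primitives. -/

section WeakDerivative

open Filter Topology

variable {X : Type*} [NormedAddCommGroup X] [NormedSpace ℝ X] [CompleteSpace X] {T : ℝ}

lemma integrableOn_smul_of_memL2 {φ : ℝ → ℝ} (hφ : Continuous φ) {w : ℝ → X} (hw : MemL2 T w) :
    IntegrableOn (fun t => φ t • w t) (Ioo 0 T) := by
  have h1 : MemLp φ 2 (timeMeasure T) := memL2_of_continuous hφ
  exact memLp_one_iff_integrable.1 (MemLp.smul (p := 2) (q := 2) hw h1)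

/-- A function with an `L²` derivative has this derivative as weak derivative. -/
theorem hasH1Deriv_of_eq_primitive (hT : 0 < T) {w w' : ℝ → X} (hw' : MemL2 T w') {x₀ : X}
    (h : ∀ t ∈ Icc 0 T, w t = x₀ + ∫ s in (0 : ℝ)..t, w' s) : HasH1Deriv T w w' := by
  have hcont : ContinuousOn w (Icc 0 T) := by
    refine ContinuousOn.congr ?_ h
    rw [continuousOn_iff_continuous_domRestrict]
    exact continuous_const.add (continuous_primitive hT.le hw'.integrable)
  have hw : MemL2 T w := by
    have h1 : MemL2 T (IccExtend hT.le ((Icc 0 T).domRestrict w)) :=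
      memL2_of_continuous (continuousOn_iff_continuous_domRestrict.1 hcont).Icc_extend'
    refine MemLp.ae_eq ?_ h1
    filter_upwards [ae_timeMeasure_mem_Ioo T] with s hs
    rw [IccExtend_of_mem _ _ (Ioo_subset_Icc_self hs)]
    rfl
  refine ⟨hw, hw', fun φ hφ hcs hsupp => ?_⟩
  have hφ0 : ∀ t ∉ Ioo 0 T, φ t = 0 := fun t ht => by
    by_contra hne
    exact ht (hsupp (subset_tsupport φ hne))
  have hdφ : Continuous (deriv φ) := hφ.continuous_deriv (by simp)
  have hi1 := integrableOn_smul_of_memL2 hdφ hw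
  have hi2 := integrableOn_smul_of_memL2 hφ.continuous hw'
  rw [← add_eq_zero_iff_eq_neg, ← integral_add hi1 hi2]
  -- Functionals reduce the claim to scalars, where the product rule applies to the form `(c, x) ↦ c
  -- * ℓ x`; the boundary terms vanish with `φ`.
  refine SeparatingDual.eq_zero_of_forall_dual_eq_zero (R := ℝ) fun ℓ => ?_
  have hi3 : IntegrableOn (fun t => deriv φ t • w t + φ t • w' t) (Ioo 0 T) := hi1.add hi2
  rw [← ℓ.integral_comp_comm hi3]
  have hφi : ∀ s, (0 : ℝ) + ∫ r in (0 : ℝ)..s, deriv φ r = φ s := fun s => by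
    rw [intervalIntegral.integral_deriv_eq_sub (fun x _ => hφ.differentiable (by simp) x)
      (hdφ.intervalIntegrable _ _), hφ0 0 (by simp)]
    ring
  have key := (intervalIntegrable_and_bilin_primitive_eq
    ((ContinuousLinearMap.mul ℝ ℝ).bilinearComp (.id ℝ ℝ) ℓ) hT.le (hdφ.intervalIntegrable 0 T)
    (intervalIntegrable_of_integrable hw'.integrable ⟨le_rfl, hT.le⟩ ⟨hT.le, le_rfl⟩) 0 x₀).2
  simp only [ContinuousLinearMap.bilinearComp_apply, hφi, ContinuousLinearMap.mul_apply',
    ContinuousLinearMap.id_apply, zero_mul, zero_add, hφ0 T (by simp)] at key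
  refine Eq.trans ?_ key.symm
  rw [intervalIntegral.integral_of_le hT.le, ← integral_Ioc_eq_integral_Ioo]
  refine setIntegral_congr_fun measurableSet_Ioc fun s hs => ?_
  simp [h s (Ioc_subset_Icc_self hs), mul_add]

lemma exists_Icc_of_isCompact_subset_Ioo (hT : 0 < T) {K : Set ℝ} (hK : IsCompact K)
    (hKT : K ⊆ Ioo 0 T) : ∃ α β, 0 < α ∧ β < T ∧ K ⊆ Icc α β := by
  rcases K.eq_empty_or_nonempty with rfl | hne
  · exact ⟨T / 2, T / 2, by linarith, by linarith, empty_subset _⟩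
  · obtain ⟨α, hα⟩ := IsCompact.exists_isLeast (α := ℝ) hK hne
    obtain ⟨β, hβ⟩ := IsCompact.exists_isGreatest (α := ℝ) hK hne
    exact ⟨α, β, (hKT hα.1).1, (hKT hβ.1).2, fun x hx => ⟨hα.2 hx, hβ.2 hx⟩⟩

/-- A test function of zero mean is the derivative of a test function. -/
lemma exists_test_primitive (hT : 0 < T) {ψ : ℝ → ℝ} (hψ : ContDiff ℝ ∞ ψ)
    (hcs : HasCompactSupport ψ) (hsupp : tsupport ψ ⊆ Ioo 0 T)
    (h0 : ∫ s in (0 : ℝ)..T, ψ s = 0) :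
    ∃ φ : ℝ → ℝ, ContDiff ℝ ∞ φ ∧ HasCompactSupport φ ∧ tsupport φ ⊆ Ioo 0 T ∧ deriv φ = ψ := by
  obtain ⟨α, β, hα, hβ, hK⟩ := exists_Icc_of_isCompact_subset_Ioo hT hcs hsupp
  have hz : ∀ x ∉ Icc α β, ψ x = 0 := fun x hx => image_eq_zero_of_notMem_tsupport fun h => hx (hK h)
  have hd : ∀ x, HasDerivAt (fun x => ∫ s in (0 : ℝ)..x, ψ s) (ψ x) x := fun x =>
    intervalIntegral.integral_hasDerivAt_right (hψ.continuous.intervalIntegrable _ _)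
      hψ.continuous.stronglyMeasurable.stronglyMeasurableAtFilter hψ.continuous.continuousAt
  have hderiv : deriv (fun x => ∫ s in (0 : ℝ)..x, ψ s) = ψ := funext fun x => (hd x).deriv
  -- The primitive vanishes to the left of `α` because `ψ` does, and to the right of `β` because `ψ`
  -- has mean zero as well.
  have hsub : Function.support (fun x => ∫ s in (0 : ℝ)..x, ψ s) ⊆ Icc α β := by
    intro x hx
    by_contra hne
    refine hx ?_
    rw [mem_Icc, not_and_or, not_le, not_le] at hne
    rcases hne with h | h
    · refine intervalIntegral.integral_zero_ae (ae_of_all _ fun s hs => hz s fun hs' => ?_)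
      rw [mem_uIoc] at hs
      rcases hs with hs | hs <;> linarith [hs'.1]
    · have e : ∫ s in x..T, ψ s = 0 := by
        refine intervalIntegral.integral_zero_ae (ae_of_all _ fun s hs => hz s fun hs' => ?_)
        rw [mem_uIoc] at hs
        rcases hs with hs | hs <;> linarith [hs'.2]
      have := intervalIntegral.integral_add_adjacent_intervals
        (hψ.continuous.intervalIntegrable (μ := volume) 0 x) (hψ.continuous.intervalIntegrable x T)
      rwa [e, add_zero, h0] at this
  have htsub : tsupport (fun x => ∫ s in (0 : ℝ)..x, ψ s) ⊆ Icc α β :=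
    closure_minimal hsub isClosed_Icc
  refine ⟨_, ?_, IsCompact.of_isClosed_subset isCompact_Icc (isClosed_tsupport _) htsub,
    fun x hx => ⟨hα.trans_le (htsub hx).1, (htsub hx).2.trans_lt hβ⟩, hderiv⟩
  rw [contDiff_infty_iff_deriv, hderiv]
  exact ⟨fun x => (hd x).differentiableAt, hψ⟩

lemma exists_normalized_test (hT : 0 < T) : ∃ η : ℝ → ℝ, ContDiff ℝ ∞ η ∧ HasCompactSupport η ∧
    tsupport η ⊆ Ioo 0 T ∧ ∫ s in (0 : ℝ)..T, η s = 1 := by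
  let b : ContDiffBump (T / 2) := ⟨T / 8, T / 4, by linarith, by linarith⟩
  have hs : tsupport (b.normed volume) ⊆ Ioo 0 T := by
    rw [b.tsupport_normed_eq, Real.closedBall_eq_Icc]
    intro x hx
    have h1 : T / 2 - T / 4 ≤ x := hx.1
    have h2 : x ≤ T / 2 + T / 4 := hx.2
    constructor <;> linarith
  refine ⟨b.normed volume, b.contDiff_normed, b.hasCompactSupport_normed, hs, ?_⟩
  rw [intervalIntegral.integral_of_le hT.le, ← b.integral_normed (μ := volume)]
  refine setIntegral_eq_integral_of_forall_compl_eq_zero fun x hx => ?_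
  by_contra hne
  exact hx (Ioo_subset_Ioc_self (hs (subset_tsupport _ hne)))

/-- A continuous function with weak derivative zero is constant. -/
lemma const_of_weak_deriv_zero (hT : 0 < T) {z : ℝ → X} (hz : ContinuousOn z (Icc 0 T))
    (h : ∀ φ : ℝ → ℝ, ContDiff ℝ ∞ φ → HasCompactSupport φ → tsupport φ ⊆ Ioo 0 T →
      ∫ t in Ioo 0 T, deriv φ t • z t = 0) : ∀ t ∈ Icc 0 T, z t = z 0 := by
  obtain ⟨η, hη, hηc, hηs, hη1⟩ := exists_normalized_test hT
  have hiz : ∀ ψ : ℝ → ℝ, Continuous ψ → IntegrableOn (fun t => ψ t • z t) (Ioo 0 T) :=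
    fun ψ hψ => ((hψ.continuousOn.smul hz).integrableOn_Icc).mono_set Ioo_subset_Icc_self
  set c := ∫ t in Ioo 0 T, η t • z t with hc
  have hIoo : ∀ ψ : ℝ → ℝ, ∫ s in (0 : ℝ)..T, ψ s = ∫ s in Ioo 0 T, ψ s := fun ψ => by
    rw [intervalIntegral.integral_of_le hT.le, integral_Ioc_eq_integral_Ioo]
  have hae : ∀ᵐ t, t ∈ Ioo 0 T → z t - c = 0 := by
    refine isOpen_Ioo.ae_eq_zero_of_integral_contDiff_smul_eq_zero
      (ContinuousOn.locallyIntegrableOn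
        ((hz.mono Ioo_subset_Icc_self).sub continuousOn_const) measurableSet_Ioo) ?_
    intro ψ hψ hψc hψs
    have hzero : ∀ t ∉ Ioo 0 T, ψ t • (z t - c) = 0 := fun t ht => by
      rw [image_eq_zero_of_notMem_tsupport fun h => ht (hψs h), zero_smul]
    rw [← setIntegral_eq_integral_of_forall_compl_eq_zero hzero]
    -- Subtracting `m * η` leaves a test function of mean zero, hence a derivative to which the
    -- hypothesis applies; the correction produces exactly the constant `c`.
    set m := ∫ s in Ioo 0 T, ψ s with hm
    have hψ0s : tsupport (fun s => ψ s - m * η s) ⊆ tsupport ψ ∪ tsupport η := by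
      refine closure_minimal (fun s hs => ?_) ((isClosed_tsupport _).union (isClosed_tsupport _))
      by_contra hne
      rw [mem_union, not_or] at hne
      refine hs ?_
      simp only [image_eq_zero_of_notMem_tsupport hne.1, image_eq_zero_of_notMem_tsupport hne.2]
      ring
    have hi1 : IntegrableOn ψ (Ioo 0 T) :=
      (hψ.continuous.integrableOn_Icc).mono_set Ioo_subset_Icc_self
    have hi2 : IntegrableOn η (Ioo 0 T) :=
      (hη.continuous.integrableOn_Icc).mono_set Ioo_subset_Icc_self
    obtain ⟨φ, hφ, hφc, hφs, hφd⟩ := exists_test_primitive hT (ψ := fun s => ψ s - m * η s)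
      (hψ.sub (contDiff_const.mul hη))
      (IsCompact.of_isClosed_subset (hψc.isCompact.union hηc.isCompact) (isClosed_tsupport _) hψ0s)
      (hψ0s.trans (union_subset hψs hηs)) (by
        rw [hIoo, integral_sub hi1 (hi2.const_mul m), integral_const_mul, ← hIoo η, hη1]
        ring)
    have h1 := h φ hφ hφc hφs
    rw [hφd] at h1
    simp only [sub_smul, mul_smul] at h1
    have hi3 : IntegrableOn (fun t => m • η t • z t) (Ioo 0 T) := (hiz η hη.continuous).smul m
    rw [integral_sub (hiz ψ hψ.continuous) hi3, integral_smul, ← hc] at h1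
    simp only [smul_sub]
    rw [integral_sub (hiz ψ hψ.continuous) (hi1.smul_const c), integral_smul_const]
    exact h1
  have h2 : z =ᵐ[volume.restrict (Ioo 0 T)] fun _ => c := by
    refine (ae_restrict_iff' measurableSet_Ioo).2 ?_
    filter_upwards [hae] with t ht hm
    exact sub_eq_zero.1 (ht hm)
  have h3 := Measure.eqOn_of_ae_eq h2 (hz.mono Ioo_subset_Icc_self) continuousOn_const
    (by rw [interior_Ioo]; exact subset_closure)
  have h4 : EqOn z (fun _ => c) (Icc 0 T) := by
    rw [← closure_Ioo hT.ne] at hz ⊢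
    exact h3.of_subset_closure hz continuousOn_const subset_closure subset_rfl
  intro t ht
  rw [h4 ht, h4 ⟨le_rfl, hT.le⟩]

/-- A continuous `H¹` function is the primitive of its weak derivative. -/
theorem HasH1Deriv.eq_primitive (hT : 0 < T) {w w' : ℝ → X} (h : HasH1Deriv T w w')
    (hw : ContinuousOn w (Icc 0 T)) : ∀ t ∈ Icc 0 T, w t = w 0 + ∫ s in (0 : ℝ)..t, w' s := by
  have hp := hasH1Deriv_of_eq_primitive hT h.memL2_deriv (x₀ := (0 : X))
    (w := fun t => ∫ s in (0 : ℝ)..t, w' s) (fun t _ => (zero_add _).symm)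
  have hpc : ContinuousOn (fun t => ∫ s in (0 : ℝ)..t, w' s) (Icc 0 T) :=
    continuousOn_iff_continuous_domRestrict.2 (continuous_primitive hT.le h.memL2_deriv.integrable)
  -- The function and the primitive of its weak derivative have the same weak derivative, so their
  -- difference is constant.
  have key := const_of_weak_deriv_zero hT (hw.sub hpc) fun φ hφ hc hs => by
    have hdφ : Continuous (deriv φ) := hφ.continuous_deriv (by simp)
    simp only [Pi.sub_apply, smul_sub]
    rw [integral_sub (integrableOn_smul_of_memL2 hdφ h.memL2)
      (integrableOn_smul_of_memL2 hdφ hp.memL2), h.weak φ hφ hc hs, hp.weak φ hφ hc hs, sub_self]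
  intro t ht
  have := key t ht
  simp only [Pi.sub_apply, intervalIntegral.integral_same, sub_zero] at this
  rw [← this]
  abel

/-- Weak derivatives are unique. -/
lemma HasH1Deriv.deriv_ae_eq {w₁ w₂ w₁' w₂' : ℝ → X} (h₁ : HasH1Deriv T w₁ w₁')
    (h₂ : HasH1Deriv T w₂ w₂') (h : EqOn w₁ w₂ (Ioo 0 T)) : w₁' =ᵐ[timeMeasure T] w₂' := by
  have hi : Integrable (fun t => w₁' t - w₂' t) (timeMeasure T) :=
    h₁.memL2_deriv.integrable.sub h₂.memL2_deriv.integrable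
  have hae : ∀ᵐ t, t ∈ Ioo 0 T → w₁' t - w₂' t = 0 := by
    refine isOpen_Ioo.ae_eq_zero_of_integral_contDiff_smul_eq_zero
      (IntegrableOn.locallyIntegrableOn hi) fun φ hφ hc hs => ?_
    have hzero : ∀ t ∉ Ioo 0 T, φ t • (w₁' t - w₂' t) = 0 := fun t ht => by
      rw [image_eq_zero_of_notMem_tsupport fun h => ht (hs h), zero_smul]
    rw [← setIntegral_eq_integral_of_forall_compl_eq_zero hzero]
    simp only [smul_sub]
    rw [integral_sub (integrableOn_smul_of_memL2 hφ.continuous h₁.memL2_deriv)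
      (integrableOn_smul_of_memL2 hφ.continuous h₂.memL2_deriv), sub_eq_zero, ← neg_inj,
      ← h₁.weak φ hφ hc hs, ← h₂.weak φ hφ hc hs]
    exact setIntegral_congr_fun measurableSet_Ioo fun t ht => by simp only [h ht]
  refine (ae_restrict_iff' measurableSet_Ioo).2 ?_
  filter_upwards [hae] with t ht hm
  exact sub_eq_zero.1 (ht hm)

end WeakDerivative

/-! ### Consequences of the inf-sup condition and reduction to a symmetric form. -/

section Constraint

variable {V H Q X Y : Type*}
  [NormedAddCommGroup V] [InnerProductSpace ℝ V] [CompleteSpace V]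
  [NormedAddCommGroup H] [InnerProductSpace ℝ H] [CompleteSpace H]
  [NormedAddCommGroup Q] [InnerProductSpace ℝ Q] [CompleteSpace Q]
  [NormedAddCommGroup X] [InnerProductSpace ℝ X] [CompleteSpace X]
  [NormedAddCommGroup Y] [NormedSpace ℝ Y]

local notation "⟪" x ", " y "⟫" => inner ℝ x y

/-- The operator `Y → X` that represents an operator `Y → X*` by Riesz' theorem. -/
noncomputable def rieszComp (L : Y →L[ℝ] StrongDual ℝ X) : Y →L[ℝ] X :=
  LinearMap.mkContinuous
    { toFun := fun y => (InnerProductSpace.toDual ℝ X).symm (L y)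
      map_add' := fun y z => by simp
      map_smul' := fun c y => by simp }
    ‖L‖ fun y => by simpa using L.le_opNorm y

lemma inner_rieszComp (L : Y →L[ℝ] StrongDual ℝ X) (y : Y) (x : X) :
    ⟪rieszComp L y, x⟫ = L y x :=
  InnerProductSpace.toDual_symm_apply

lemma norm_rieszComp (L : Y →L[ℝ] StrongDual ℝ X) (y : Y) : ‖rieszComp L y‖ = ‖L y‖ :=
  LinearIsometryEquiv.norm_map (InnerProductSpace.toDual ℝ X).symm (L y)

/-- The inf-sup condition says that `B*` is bounded below. -/
lemma InfSup.exists_norm_le {B : V →L[ℝ] StrongDual ℝ Q} (hB : InfSup B) :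
    ∃ β : ℝ, 0 < β ∧ ∀ q, β * ‖q‖ ≤ ‖B.flip q‖ := by
  obtain ⟨β, hβ, h⟩ := hB
  refine ⟨β, hβ, fun q => ?_⟩
  rcases eq_or_ne q 0 with rfl | hq
  · simp
  have hq' : 0 < ‖q‖ := norm_pos_iff.2 hq
  have h1 : (β : EReal) ≤ ((‖B.flip q‖ / ‖q‖ : ℝ) : EReal) := by
    refine (h.trans (iInf_le _ ⟨q, hq⟩)).trans (iSup_le fun v => EReal.coe_le_coe_iff.2 ?_)
    have hv : 0 < ‖(v : V)‖ := norm_pos_iff.2 v.2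
    rw [div_le_div_iff₀ (by positivity) hq']
    have := (Real.le_norm_self _).trans ((B.flip q).le_opNorm v)
    rw [ContinuousLinearMap.flip_apply] at this
    nlinarith
  rwa [EReal.coe_le_coe_iff, le_div_iff₀ hq'] at h1

lemma InfSup.flip_injective {B : V →L[ℝ] StrongDual ℝ Q} (hB : InfSup B) :
    Function.Injective B.flip := by
  obtain ⟨β, hβ, h⟩ := hB.exists_norm_le
  refine (injective_iff_map_eq_zero _).2 fun q hq => ?_
  have := h q
  rw [hq, norm_zero] at this
  exact norm_le_zero_iff.1 (nonpos_of_mul_nonpos_right this hβ)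

/-- The inf-sup condition gives a bounded right inverse of `B`. -/
lemma InfSup.exists_rightInverse {B : V →L[ℝ] StrongDual ℝ Q} (hB : InfSup B) :
    ∃ G : StrongDual ℝ Q →L[ℝ] V, ∀ q, B (G q) = q := by
  obtain ⟨β, hβ, h⟩ := hB.exists_norm_le
  set M : Q →L[ℝ] V := rieszComp B.flip with hM
  have hMs : ∀ q v, ⟪M q, v⟫ = B v q := fun q v => inner_rieszComp _ _ _
  -- Bounded below means that `M* M` is coercive on `Q`. In Riesz coordinates `B = M*`, so `M (M*
  -- M)⁻¹` is a right inverse.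
  have hc : IsCoercive ((innerSL ℝ (E := V)).bilinearComp M M) := by
    refine ⟨β ^ 2, by positivity, fun q => ?_⟩
    change _ ≤ ⟪M q, M q⟫
    rw [real_inner_self_eq_norm_sq, hM, norm_rieszComp]
    have h1 : 0 ≤ β * ‖q‖ := by positivity
    calc β ^ 2 * ‖q‖ * ‖q‖ = (β * ‖q‖) ^ 2 := by ring
      _ ≤ _ := by gcongr; exact h q
  refine ⟨M.comp ((hc.continuousLinearEquivOfBilin.symm : Q →L[ℝ] Q).comp
    (rieszComp (.id ℝ (StrongDual ℝ Q)))), fun q => ?_⟩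
  ext p
  set y := hc.continuousLinearEquivOfBilin.symm (rieszComp (.id ℝ (StrongDual ℝ Q)) q) with hy
  change B (M y) p = q p
  rw [← hMs, real_inner_comm]
  have h1 : ⟪M y, M p⟫ = ⟪hc.continuousLinearEquivOfBilin y, p⟫ :=
    (hc.continuousLinearEquivOfBilin_apply y p).symm
  rw [h1, hy, ContinuousLinearEquiv.apply_symm_apply, inner_rieszComp]
  rfl

/-- Functionals that vanish on `ker B` are of the form `B* q`, with `q` depending continuously on
the functional. -/
lemma exists_multiplier_map {B : V →L[ℝ] StrongDual ℝ Q} {G : StrongDual ℝ Q →L[ℝ] V}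
    (hG : ∀ q, B (G q) = q) : ∃ Λ : StrongDual ℝ V →L[ℝ] Q,
      ∀ ℓ : StrongDual ℝ V, (∀ v, B v = 0 → ℓ v = 0) → B.flip (Λ ℓ) = ℓ := by
  -- The multiplier represents `ℓ ∘ G`. It works because `v - G (B v)` lies in `ker B`, where `ℓ`
  -- vanishes.
  set L : StrongDual ℝ V →L[ℝ] StrongDual ℝ Q :=
    (ContinuousLinearMap.compL ℝ Q V ℝ).flip (G.comp (innerSL ℝ (E := Q))) with hL
  refine ⟨rieszComp L, fun ℓ hℓ => ?_⟩
  ext v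
  rw [ContinuousLinearMap.flip_apply]
  set y := rieszComp (.id ℝ (StrongDual ℝ Q)) (B v) with hy
  have h1 : ∀ q, B v q = ⟪y, q⟫ := fun q => (inner_rieszComp _ _ _).symm
  rw [h1, real_inner_comm, inner_rieszComp]
  change ℓ (G (innerSL ℝ y)) = ℓ v
  have h2 : innerSL ℝ y = B v := by
    ext q
    exact (h1 q).symm
  rw [h2, ← sub_eq_zero, ← map_sub]
  exact hℓ _ (by rw [map_sub, hG, sub_self])

/-- A right inverse of `B` with values in the `a`-orthogonal complement of `ker B`. -/
lemma exists_orthogonal_rightInverse {B : V →L[ℝ] StrongDual ℝ Q} {G : StrongDual ℝ Q →L[ℝ] V}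
    (hG : ∀ q, B (G q) = q) {a : V →L[ℝ] V →L[ℝ] ℝ}
    (ha : IsCoercive (a.bilinearComp B.ker.subtypeL B.ker.subtypeL)) :
    ∃ G' : StrongDual ℝ Q →L[ℝ] V, (∀ q, B (G' q) = q) ∧ ∀ q, ∀ v ∈ B.ker, a (G' q) v = 0 := by
  -- The `a`-orthogonal projection onto `ker B`; the new right inverse is `G - P G`. Coercivity of
  -- `a` is needed on `ker B` only.
  set P : V →L[ℝ] B.ker := (ha.continuousLinearEquivOfBilin.symm : B.ker →L[ℝ] B.ker).comp
    (rieszComp (a.bilinearComp (.id ℝ V) B.ker.subtypeL)) with hP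
  have hPs : ∀ v (w : B.ker), a (P v) w = a v w := fun v w => by
    have h1 : a (P v) w = ⟪ha.continuousLinearEquivOfBilin (P v), w⟫ :=
      (ha.continuousLinearEquivOfBilin_apply (P v) w).symm
    rw [h1, hP, ContinuousLinearMap.comp_apply, ContinuousLinearEquiv.coe_coe,
      ContinuousLinearEquiv.apply_symm_apply, inner_rieszComp]
    rfl
  refine ⟨G - B.ker.subtypeL.comp (P.comp G), fun q => ?_, fun q v hv => ?_⟩
  · have h1 : B (P (G q)) = 0 := (P (G q)).2
    change B (G q - P (G q)) = q
    rw [map_sub, h1, sub_zero, hG]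
  · change a (G q - P (G q)) v = 0
    rw [map_sub, sub_apply, hPs (G q) ⟨v, hv⟩, sub_self]

/-- The symmetric part shifted by a multiple of the `H`-inner product is elliptic on `ker B`. -/
lemma exists_shifted_form {ι : V →L[ℝ] H} {A : V →L[ℝ] StrongDual ℝ V}
    (hA : HasSelfAdjointPrincipalPart ι A) {K : Submodule ℝ V} (hAell : EllipticOn A K) :
    ∃ (a : V →L[ℝ] V →L[ℝ] ℝ) (D : V →L[ℝ] H), (∀ v w, a v w = a w v) ∧
      IsCoercive (a.bilinearComp K.subtypeL K.subtypeL) ∧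
      ∀ v w, A v w = a v w - ⟪D v, ι w⟫ := by
  obtain ⟨A₁, A₂, hsym, hA⟩ := hA
  obtain ⟨μ, hμ, hell⟩ := hAell
  -- The least shift for which Young's inequality absorbs `(A₂ v, ι v)` at the cost of half the
  -- ellipticity constant: the remainder is then a perfect square.
  set κ := ‖A₂‖ ^ 2 / (2 * μ) with hκ
  have hAvw : ∀ v w, A v w = A₁ v w + ⟪A₂ v, ι w⟫ := fun v w => by
    rw [hA]; rfl
  let b : V →L[ℝ] V →L[ℝ] ℝ := (innerSL ℝ (E := H)).bilinearComp ι ι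
  refine ⟨A₁ + κ • b, κ • ι - A₂, fun v w => ?_,
    ⟨μ / 2, by positivity, fun v => ?_⟩, fun v w => ?_⟩
  · change A₁ v w + κ * ⟪ι v, ι w⟫ = A₁ w v + κ * ⟪ι w, ι v⟫
    rw [hsym, real_inner_comm]
  · change μ / 2 * ‖(v : V)‖ * ‖(v : V)‖ ≤ A₁ v v + κ * ⟪ι v, ι v⟫
    have h1 := hell v v.2
    rw [hAvw] at h1
    have h2 : ⟪A₂ v, ι v⟫ ≤ ‖A₂‖ * ‖(v : V)‖ * ‖ι v‖ :=
      (real_inner_le_norm _ _).trans (by gcongr; exact A₂.le_opNorm _)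
    have h3 : κ * ‖ι v‖ ^ 2 - ‖A₂‖ * ‖(v : V)‖ * ‖ι v‖ + μ / 2 * ‖(v : V)‖ ^ 2 =
        (‖A₂‖ * ‖ι v‖ - μ * ‖(v : V)‖) ^ 2 / (2 * μ) := by
      rw [hκ]; field_simp; ring
    have h4 : 0 ≤ (‖A₂‖ * ‖ι v‖ - μ * ‖(v : V)‖) ^ 2 / (2 * μ) := by positivity
    rw [real_inner_self_eq_norm_sq]
    nlinarith
  · rw [hAvw]
    change _ = A₁ v w + κ * ⟪ι v, ι w⟫ - ⟪κ • ι v - A₂ v, ι w⟫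
    rw [inner_sub_left, real_inner_smul_left]
    ring

end Constraint

/-! ### The semilinear equation on `ker B` as a causal fixed point problem. -/

section ConstrainedEvolution

variable {V H Q : Type*}
  [NormedAddCommGroup V] [InnerProductSpace ℝ V] [CompleteSpace V]
  [NormedAddCommGroup H] [InnerProductSpace ℝ H] [CompleteSpace H]
  [NormedAddCommGroup Q] [InnerProductSpace ℝ Q] [CompleteSpace Q] {T : ℝ} {f : ℝ → V → H}

local notation "⟪" x ", " y "⟫" => inner ℝ x y

/-- For inputs that agree up to `s` the integral effectively starts at `s`, whence the factor `√(t -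
s)` and the increment `κ t - κ s` in the causal estimates. -/
lemma integral_le_of_eq_zero_before {φ ψ : ℝ → ℝ} (hφ : Integrable φ (timeMeasure T))
    (hψ : Integrable ψ (timeMeasure T)) {s t : Icc 0 T} (hst : s ≤ t)
    (h0 : ∀ τ ∈ Ioc 0 (s : ℝ), φ τ = 0)
    (hle : ∀ᵐ τ ∂timeMeasure T, τ ∈ Icc (s : ℝ) t → φ τ ≤ ψ τ) :
    ∫ τ in (0 : ℝ)..t, φ τ ≤ ∫ τ in (s : ℝ)..t, ψ τ := by
  have hm0 : (0 : ℝ) ∈ Icc 0 T := ⟨le_rfl, s.2.1.trans s.2.2⟩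
  have h1 : ∫ τ in (0 : ℝ)..s, φ τ = 0 := by
    rw [intervalIntegral.integral_of_le s.2.1]
    exact setIntegral_eq_zero_of_forall_eq_zero h0
  rw [← intervalIntegral.integral_add_adjacent_intervals
    (intervalIntegrable_of_integrable hφ hm0 s.2) (intervalIntegrable_of_integrable hφ s.2 t.2),
    h1, zero_add]
  refine intervalIntegral.integral_mono_ae_restrict hst
    (intervalIntegrable_of_integrable hφ s.2 t.2) (intervalIntegrable_of_integrable hψ s.2 t.2) ?_
  rw [Measure.restrict_congr_set Ioc_ae_eq_Icc.symm]
  have h2 : ∀ᵐ τ ∂volume.restrict (Ioc 0 (t : ℝ)), τ ∈ Icc (s : ℝ) t → φ τ ≤ ψ τ :=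
    ae_restrict_Ioc_of_ae_timeMeasure hle t.2
  have h3 := ae_restrict_of_ae_restrict_of_subset (Ioc_subset_Ioc_left s.2.1) h2
  filter_upwards [h3, ae_restrict_mem measurableSet_Ioc] with τ h hτ
  exact h (Ioc_subset_Icc_self hτ)

lemma integrable_norm_sq_comp_sub (hf : Caratheodory T f) (hg : LinearGrowth T f) (hT : 0 ≤ T)
    (u v : C(Icc 0 T, V)) :
    Integrable (fun τ => ‖f τ (IccExtend hT u τ) - f τ (IccExtend hT v τ)‖ ^ 2)
      (timeMeasure T) :=
  integrable_norm_sq (MemLp.sub (hf.memL2_comp hg u.continuous.Icc_extend')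
    (hf.memL2_comp hg v.continuous.Icc_extend'))

lemma causalLocallyLipschitz_of_estimate (hf : Caratheodory T f) (hg : LinearGrowth T f)
    (hl : LocallyLipschitzInState T f) (hT : 0 ≤ T) {Φ : C(Icc 0 T, V) → C(Icc 0 T, V)} {C : ℝ}
    (hC : 0 ≤ C) (hΦ : ∀ u v (t : Icc 0 T), ‖Φ u t - Φ v t‖ ^ 2 ≤
      C * ∫ τ in (0 : ℝ)..t, ‖f τ (IccExtend hT u τ) - f τ (IccExtend hT v τ)‖ ^ 2) :
    CausalLocallyLipschitz Φ := by
  intro x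
  obtain ⟨r, hr, L, hL, h⟩ := hl x
  refine ⟨r, hr, √C * L, by positivity, fun s t u v D hst heq hD => ?_⟩
  have hD0 : 0 ≤ D := (norm_nonneg _).trans (hD s le_rfl hst).2.2
  have hst' : (0 : ℝ) ≤ t - s := sub_nonneg.2 (Subtype.coe_le_coe.2 hst)
  have key := integral_le_of_eq_zero_before (integrable_norm_sq_comp_sub hf hg hT u v)
    (integrable_const ((L * D) ^ 2)) hst (fun τ hτ => by
      have hm : τ ∈ Icc 0 T := ⟨hτ.1.le, hτ.2.trans s.2.2⟩
      rw [IccExtend_of_mem _ _ hm, IccExtend_of_mem _ _ hm, heq ⟨τ, hm⟩ hτ.2, sub_self, norm_zero]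
      simp) (by
      filter_upwards [h] with τ hτ hm
      have hmem : τ ∈ Icc 0 T := ⟨s.2.1.trans hm.1, hm.2.trans t.2.2⟩
      obtain ⟨h1, h2, h3⟩ := hD ⟨τ, hmem⟩ hm.1 hm.2
      rw [IccExtend_of_mem _ _ hmem, IccExtend_of_mem _ _ hmem]
      gcongr
      exact (hτ _ h1 _ h2).trans (by gcongr))
  rw [intervalIntegral.integral_const, smul_eq_mul] at key
  refine abs_le_of_sq_le_sq' ?_ (by positivity) |>.2
  refine (hΦ u v t).trans ((mul_le_mul_of_nonneg_left key hC).trans (le_of_eq ?_))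
  simp only [mul_pow, Real.sq_sqrt hC, Real.sq_sqrt hst']
  ring

lemma causalLinearGrowth_of_estimate (hf : Caratheodory T f) (hg : LinearGrowth T f)
    (hT : 0 ≤ T) {Φ : C(Icc 0 T, V) → C(Icc 0 T, V)} {C : ℝ}
    (hC : 0 ≤ C) (hΦ : ∀ u v (t : Icc 0 T), ‖Φ u t - Φ v t‖ ^ 2 ≤
      C * ∫ τ in (0 : ℝ)..t, ‖f τ (IccExtend hT u τ) - f τ (IccExtend hT v τ)‖ ^ 2) :
    ∃ κ : Icc 0 T → ℝ, Continuous κ ∧ CausalLinearGrowth Φ κ := by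
  obtain ⟨k, hk, hkf⟩ := id hg
  have hki : Integrable (fun τ => 4 * k τ ^ 2) (timeMeasure T) :=
    ((memLp_two_iff_integrable_sq hk.aestronglyMeasurable).1 hk).const_mul 4
  -- The factor 4 arises since two values of `f`, each at most `k τ * (1 + M)`, are subtracted
  -- before squaring. Continuity of `κ` uses `k ∈ L²`.
  refine ⟨fun t => C * ∫ τ in (0 : ℝ)..t, 4 * k τ ^ 2,
    continuous_const.mul (continuous_primitive hT hki), fun s t u v M hM hst heq hb => ?_⟩
  have hm0 : (0 : ℝ) ∈ Icc 0 T := ⟨le_rfl, hT⟩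
  have key := integral_le_of_eq_zero_before (integrable_norm_sq_comp_sub hf hg hT u v)
    (hki.mul_const ((1 + M) ^ 2)) hst (fun τ hτ => by
      have hm : τ ∈ Icc 0 T := ⟨hτ.1.le, hτ.2.trans s.2.2⟩
      rw [IccExtend_of_mem _ _ hm, IccExtend_of_mem _ _ hm, heq ⟨τ, hm⟩ hτ.2, sub_self, norm_zero]
      simp) (by
      filter_upwards [hf.ae_norm_comp_le hkf (u.continuous.Icc_extend' (h := hT)),
        hf.ae_norm_comp_le hkf (v.continuous.Icc_extend' (h := hT))] with τ h1 h2 hm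
      have hmem : τ ∈ Icc 0 T := ⟨s.2.1.trans hm.1, hm.2.trans t.2.2⟩
      obtain ⟨h3, h4⟩ := hb ⟨τ, hmem⟩ hm.2
      rw [IccExtend_of_mem _ _ hmem] at h1 h2 ⊢
      rw [IccExtend_of_mem _ _ hmem]
      have hk0 : 0 ≤ k τ := by
        by_contra! hneg
        have := norm_nonneg (f τ (u ⟨τ, hmem⟩))
        have := norm_nonneg (u ⟨τ, hmem⟩)
        nlinarith
      have h5 : ‖f τ (u ⟨τ, hmem⟩)‖ ≤ k τ * (1 + M) := h1.trans (by gcongr)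
      have h6 : ‖f τ (v ⟨τ, hmem⟩)‖ ≤ k τ * (1 + M) := h2.trans (by gcongr)
      have h7 := norm_sub_le (f τ (u ⟨τ, hmem⟩)) (f τ (v ⟨τ, hmem⟩))
      calc _ ≤ (2 * (k τ * (1 + M))) ^ 2 := by gcongr; linarith
        _ = _ := by ring)
  rw [intervalIntegral.integral_mul_const] at key
  have hsub := intervalIntegral.integral_interval_sub_left
    (intervalIntegrable_of_integrable hki hm0 t.2) (intervalIntegrable_of_integrable hki hm0 s.2)
  refine (hΦ u v t).trans ((mul_le_mul_of_nonneg_left key hC).trans (le_of_eq ?_))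
  rw [← mul_sub, hsub]
  ring

set_option maxHeartbeats 1000000 in
/-- Existence and uniqueness for the evolution equation restricted to test functions in `ker B`. -/
theorem existsUnique_constrained_evolution (hT : 0 < T) {ι : V →L[ℝ] H}
    (hι : Function.Injective ι) {B : V →L[ℝ] StrongDual ℝ Q} {a : V →L[ℝ] V →L[ℝ] ℝ}
    (hsym : ∀ v w, a v w = a w v)
    (ha : IsCoercive (a.bilinearComp B.ker.subtypeL B.ker.subtypeL))
    {G : StrongDual ℝ Q →L[ℝ] V} (hG : ∀ q, B (G q) = q) (hGa : ∀ q, ∀ v ∈ B.ker, a (G q) v = 0)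
    (hf : Caratheodory T f) (hgr : LinearGrowth T f) (hl : LocallyLipschitzInState T f)
    {g g' : ℝ → StrongDual ℝ Q} (hg : HasH1Deriv T g g') (hgc : ContinuousOn g (Icc 0 T))
    {u₀ : V} (hu₀ : B u₀ = g 0) :
    ∃! u : C(Icc 0 T, V), ∃ w : Lp H 2 (timeMeasure T),
      (∀ t : Icc 0 T, ι (u t) = ι u₀ + ∫ s in (0 : ℝ)..t, w s) ∧ (∀ t : Icc 0 T, B (u t) = g t) ∧
      u ⟨0, le_rfl, hT.le⟩ = u₀ ∧ ∀ᵐ s ∂timeMeasure T, ∀ hs : s ∈ Icc 0 T, ∀ v ∈ B.ker,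
        ⟪w s, ι v⟫ + a (u ⟨s, hs⟩) v = ⟪f s (u ⟨s, hs⟩), ι v⟫ := by
  have hm0 : (0 : ℝ) ∈ Icc 0 T := ⟨le_rfl, hT.le⟩
  set j : B.ker →L[ℝ] H := ι.comp B.ker.subtypeL with hj
  have hjinj : Function.Injective j := hι.comp Subtype.val_injective
  have hasym : ∀ v w, (a.bilinearComp B.ker.subtypeL B.ker.subtypeL) v w =
    (a.bilinearComp B.ker.subtypeL B.ker.subtypeL) w v := fun v w => hsym _ _
  obtain ⟨S, C, hC, hS1, hS2, hS3⟩ := exists_linear_evolution (T := T) ha hasym hjinj hT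
  -- the part of the solution that is fixed by the constraint
  let uc : C(Icc 0 T, V) := ⟨fun t => G (g t),
    G.continuous.comp (continuousOn_iff_continuous_domRestrict.1 hgc)⟩
  have huc : ∀ t : Icc 0 T, uc t = G (g t) := fun t => rfl
  have hd' : MemLp (fun t => ι (G (g' t))) 2 (timeMeasure T) :=
    (ι.comp G).comp_memLp' hg.memL2_deriv
  set d : Lp H 2 (timeMeasure T) := hd'.toLp _ with hd
  have hdc : d =ᵐ[timeMeasure T] fun t => ι (G (g' t)) := MemLp.coeFn_toLp _
  have hucd : ∀ t : Icc 0 T, ι (uc t) = ι (uc ⟨0, hm0⟩) + ∫ s in (0 : ℝ)..t, d s := fun t => by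
    have hcomm := (ι.comp G).intervalIntegral_comp_comm
      (intervalIntegrable_of_integrable hg.memL2_deriv.integrable hm0 t.2)
    rw [huc, huc, hg.eq_primitive hT hgc t t.2, map_add, map_add,
      intervalIntegral_congr_of_ae hdc t.2]
    exact congrArg _ hcomm.symm
  have hz₀ : u₀ - uc ⟨0, hm0⟩ ∈ B.ker := by
    change B (u₀ - G (g 0)) = 0
    rw [map_sub, hG, hu₀, sub_self]
  set z₀ : B.ker := ⟨u₀ - uc ⟨0, hm0⟩, hz₀⟩ with hz₀def
  have hNm : ∀ u : C(Icc 0 T, V), MemLp (fun t => f t (IccExtend hT.le u t)) 2 (timeMeasure T) :=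
    fun u => hf.memL2_comp hgr u.continuous.Icc_extend'
  set N : C(Icc 0 T, V) → Lp H 2 (timeMeasure T) := fun u => (hNm u).toLp _ - d with hN
  have hNc : ∀ u, ∀ᵐ s ∂timeMeasure T, ∀ hs : s ∈ Icc 0 T, N u s = f s (u ⟨s, hs⟩) - d s := by
    intro u
    filter_upwards [Lp.coeFn_sub ((hNm u).toLp _) d, (hNm u).coeFn_toLp] with s h1 h2 hs
    rw [hN, h1, Pi.sub_apply, h2, IccExtend_of_mem _ _ hs]
  set data : C(Icc 0 T, V) → WithLp 2 (B.ker × Lp H 2 (timeMeasure T)) :=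
    fun u => WithLp.toLp 2 (z₀, N u) with hdata
  -- The nonlinearity is frozen at `u` and the linear problem solved in `ker B`. Initial value and
  -- `d` do not depend on `u`, so differences of `Φ` see only differences of `f`.
  set Φ : C(Icc 0 T, V) → C(Icc 0 T, V) := fun u =>
    uc + (B.ker.subtypeL.compLeftContinuous ℝ (Icc 0 T)) (S (data u)).1 with hΦ
  have hΦa : ∀ u t, Φ u t = uc t + ((S (data u)).1 t : V) := fun u t => rfl
  have hinit : ∀ u, Φ u ⟨0, le_rfl, hT.le⟩ = u₀ := fun u => by
    have h1 := hS1 (data u) ⟨0, hm0⟩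
    rw [intervalIntegral.integral_same, add_zero] at h1
    rw [hΦa, hjinj h1]
    change uc ⟨0, hm0⟩ + (u₀ - uc ⟨0, hm0⟩) = u₀
    abel
  have hest : ∀ u v (t : Icc 0 T), ‖Φ u t - Φ v t‖ ^ 2 ≤
      C * ∫ τ in (0 : ℝ)..t, ‖f τ (IccExtend hT.le u τ) - f τ (IccExtend hT.le v τ)‖ ^ 2 := by
    intro u v t
    have h1 := hS3 (data u - data v) t
    have h2 : Φ u t - Φ v t = (((S (data u - data v)).1 t : B.ker) : V) := by
      rw [hΦa, hΦa, map_sub]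
      change _ = ((S (data u)).1 t : V) - ((S (data v)).1 t : V)
      abel
    have h3 : (data u - data v).fst = 0 := sub_self z₀
    have h4 : (data u - data v).snd = N u - N v := rfl
    rw [h3, h4, norm_zero] at h1
    rw [h2]
    refine h1.trans (mul_le_mul_of_nonneg_left (le_of_eq ?_) hC)
    rw [zero_pow two_ne_zero, zero_add]
    refine intervalIntegral_congr_of_ae ?_ t.2
    filter_upwards [Lp.coeFn_sub (N u) (N v), hNc u, hNc v, ae_timeMeasure_mem_Ioo T]
      with s e1 e2 e3 hs
    have hs' := Ioo_subset_Icc_self hs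
    rw [e1, Pi.sub_apply, e2 hs', e3 hs', IccExtend_of_mem _ _ hs', IccExtend_of_mem _ _ hs',
      sub_sub_sub_cancel_right]
  obtain ⟨κ, hκ, hgrowth⟩ := causalLinearGrowth_of_estimate hf hgr hT.le hC hest
  obtain ⟨u, hu, huniq⟩ := existsUnique_fixedPoint_of_causal
    (causalLocallyLipschitz_of_estimate hf hgr hl hT.le hC hest) hgrowth hκ hT.le hinit
  refine ⟨u, ⟨(S (data u)).2 + d, fun t => ?_, fun t => ?_, ?_, ?_⟩, ?_⟩
  · have h1 := hS1 (data u) t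
    have h2 : u t = uc t + ((S (data u)).1 t : V) := by rw [← hΦa, hu]
    have h3 : ι ((S (data u)).1 t : V) = ι z₀ + ∫ s in (0 : ℝ)..t, (S (data u)).2 s := h1
    have h4 : ι (z₀ : V) = ι u₀ - ι (uc ⟨0, hm0⟩) := map_sub ι _ _
    rw [h2, map_add, h3, hucd, h4, intervalIntegral_congr_of_ae (Lp.coeFn_add (S (data u)).2 d) t.2]
    simp only [Pi.add_apply]
    rw [intervalIntegral.integral_add
      (intervalIntegrable_of_integrable (integrable_coe_Lp (S (data u)).2) hm0 t.2)
      (intervalIntegrable_of_integrable (integrable_coe_Lp d) hm0 t.2)]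
    abel
  · have h2 : u t = uc t + ((S (data u)).1 t : V) := by rw [← hΦa, hu]
    have h3 : B ((S (data u)).1 t : V) = 0 := ((S (data u)).1 t).2
    rw [h2, map_add, h3, huc, hG, add_zero]
  · rw [← hinit u, hu]
  · filter_upwards [hS2 (data u), hNc u, Lp.coeFn_add (S (data u)).2 d] with s h1 h2 h3 hs v hv
    have h4 : u ⟨s, hs⟩ = uc ⟨s, hs⟩ + ((S (data u)).1 ⟨s, hs⟩ : V) := by rw [← hΦa, hu]
    have h5 : ⟪(S (data u)).2 s, ι v⟫ + a ((S (data u)).1 ⟨s, hs⟩ : V) v =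
      ⟪N u s, ι v⟫ := h1 hs ⟨v, hv⟩
    have h6 : a (u ⟨s, hs⟩) v = a ((S (data u)).1 ⟨s, hs⟩ : V) v := by
      rw [h4, map_add, add_apply, huc, hGa _ v hv, zero_add]
    rw [h2 hs, inner_sub_left] at h5
    rw [h3, h6, Pi.add_apply, inner_add_left]
    linarith
  · rintro y ⟨w, hy1, hy2, hy3, hy4⟩
    refine huniq y ?_
    have hyz : ∀ t, y t - uc t ∈ B.ker := fun t => by
      change B (y t - uc t) = 0
      rw [map_sub, hy2, huc, hG, sub_self]
    let z : C(Icc 0 T, B.ker) := ⟨fun t => ⟨y t - uc t, hyz t⟩,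
      (y.continuous.sub uc.continuous).subtype_mk _⟩
    -- A solution `y` and the linear solution with data frozen at `y` differ, after removing `uc`,
    -- by a solution of the homogeneous problem. It vanishes, so `y` is a fixed point of `Φ`.
    have hzero := eq_zero_of_linear_evolution ha j hT (z := z - (S (data y)).1)
      (w := w - d - (S (data y)).2) (fun t => by
        have h1 : j ((z - (S (data y)).1) t) = ι (y t) - ι (uc t) - j ((S (data y)).1 t) := by
          rw [ContinuousMap.sub_apply, map_sub j, ← map_sub ι]
          rfl
        have h4 : j (data y).fst = ι u₀ - ι (uc ⟨0, hm0⟩) := map_sub ι _ _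
        have iw := intervalIntegrable_of_integrable (integrable_coe_Lp w) hm0 t.2
        have idd := intervalIntegrable_of_integrable (integrable_coe_Lp d) hm0 t.2
        have iS := intervalIntegrable_of_integrable (integrable_coe_Lp (S (data y)).2) hm0 t.2
        have h5 : (w - d - (S (data y)).2 : Lp H 2 (timeMeasure T)) =ᵐ[timeMeasure T]
            fun s => w s - d s - (S (data y)).2 s := by
          filter_upwards [Lp.coeFn_sub (w - d) (S (data y)).2, Lp.coeFn_sub w d] with s e1 e2
          rw [e1, Pi.sub_apply, e2, Pi.sub_apply]
        rw [h1, hy1, hucd, hS1, h4, intervalIntegral_congr_of_ae h5 t.2,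
          intervalIntegral.integral_sub (iw.sub idd) iS, intervalIntegral.integral_sub iw idd]
        abel) (by
        filter_upwards [hS2 (data y), hNc y, hy4, Lp.coeFn_sub (w - d) (S (data y)).2,
          Lp.coeFn_sub w d] with s h1 h2 h3 e1 e2 hs v
        have h5 : ⟪(S (data y)).2 s, ι v⟫ + a ((S (data y)).1 ⟨s, hs⟩ : V) v =
          ⟪N y s, ι v⟫ := h1 hs v
        have h6 := h3 hs v v.2
        have h7 : (a.bilinearComp B.ker.subtypeL B.ker.subtypeL)
            ((z - (S (data y)).1) ⟨s, hs⟩) v =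
            a (y ⟨s, hs⟩ - uc ⟨s, hs⟩ - ((S (data y)).1 ⟨s, hs⟩ : V)) v := rfl
        have h8 : j v = ι v := rfl
        rw [h2 hs, inner_sub_left] at h5
        rw [e1, Pi.sub_apply, e2, Pi.sub_apply, h7, h8, map_sub, map_sub, sub_apply, sub_apply,
          huc, hGa _ v v.2, inner_sub_left, inner_sub_left]
        linarith)
    ext t
    have h1 : (z t : V) = (S (data y)).1 t := congrArg Subtype.val
      (DFunLike.congr_fun (sub_eq_zero.1 hzero) t)
    rw [hΦa, ← h1]
    change uc t + (y t - uc t) = y t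
    abel

end ConstrainedEvolution

end PDAE

/-! ### Recovery of the multiplier and conclusion. -/

theorem mainTheorem1
    {V H Q : Type*}
    [NormedAddCommGroup V] [InnerProductSpace ℝ V] [CompleteSpace V]
    [NormedAddCommGroup H] [InnerProductSpace ℝ H] [CompleteSpace H]
    [NormedAddCommGroup Q] [InnerProductSpace ℝ Q] [CompleteSpace Q]
    (T : ℝ) (hT : 0 < T)
    (ι : V →L[ℝ] H) (hι : PDAE.IsGelfandEmbedding ι)
    (B : V →L[ℝ] StrongDual ℝ Q) (hB : PDAE.InfSup B)
    (A : V →L[ℝ] StrongDual ℝ V)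
    (hA : PDAE.HasSelfAdjointPrincipalPart ι A)
    (hAell : PDAE.EllipticOn A B.ker)
    (g : ℝ → StrongDual ℝ Q) (hg : PDAE.MemH1 T g) (hgc : ContinuousOn g (Set.Icc 0 T))
    (f : ℝ → V → H) (hf : PDAE.Caratheodory T f)
    (hgrowth : PDAE.LinearGrowth T f)
    (hlip : PDAE.LocallyLipschitzInState T f)
    (u₀ : V) (hu₀ : B u₀ = g 0) :
    ∃ (u : ℝ → V) (lam : ℝ → Q),
      PDAE.IsSolution T ι A B f g u₀ u lam ∧
      ∀ (v : ℝ → V) (ν : ℝ → Q), PDAE.IsSolution T ι A B f g u₀ v ν →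
        Set.EqOn v u (Set.Icc 0 T) ∧ ν =ᵐ[PDAE.timeMeasure T] lam := by
  obtain ⟨a, D, hsym, hcoer, hAa⟩ := PDAE.exists_shifted_form hA hAell
  obtain ⟨G₀, hG₀⟩ := hB.exists_rightInverse
  obtain ⟨G, hG, hGa⟩ := PDAE.exists_orthogonal_rightInverse hG₀ hcoer
  obtain ⟨Λ, hΛ⟩ := PDAE.exists_multiplier_map hG
  obtain ⟨g', hg'⟩ := hg
  obtain ⟨u, ⟨w, hw, hBu, hu0, heq⟩, huniq⟩ := PDAE.existsUnique_constrained_evolution hT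
    hι.injective hsym hcoer hG hGa (hf.add_clm D) (hgrowth.add_clm D) (hlip.add_clm D) hg' hgc hu₀
  set U : ℝ → V := IccExtend hT.le u with hU
  have hUc : Continuous U := u.continuous.Icc_extend'
  have hUm : ∀ t (ht : t ∈ Icc 0 T), U t = u ⟨t, ht⟩ := fun t ht => IccExtend_of_mem _ _ ht
  have hw2 : PDAE.MemL2 T w := Lp.memLp w
  have hUH1 : PDAE.HasH1Deriv T (fun t => ι (U t)) w :=
    PDAE.hasH1Deriv_of_eq_primitive hT hw2 (x₀ := ι u₀) fun t ht => by rw [hUm t ht]; exact hw ⟨t, ht⟩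
  let J : H →L[ℝ] StrongDual ℝ V :=
    ((ContinuousLinearMap.compL ℝ V H ℝ).flip ι).comp (innerSL ℝ (E := H))
  have hJ : ∀ h, J h = PDAE.toDualV ι h := fun h => rfl
  have hJv : ∀ h v, PDAE.toDualV ι h v = inner ℝ h (ι v) := fun h v => rfl
  -- The residual that `B* λ` must equal. It is formed with the original `f` and `A`, as `D` cancels
  -- between the form and the right-hand side; `Λ` then carries it from `L²(0,T;V*)` to `L²(0,T;Q)`.
  set ℓ : ℝ → StrongDual ℝ V := fun t => J (f t (U t)) - J (w t) - A (U t) with hℓ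
  have hℓ2 : PDAE.MemL2 T ℓ :=
    MemLp.sub (MemLp.sub (J.comp_memLp' (hf.memL2_comp hgrowth hUc)) (J.comp_memLp' hw2))
      (A.comp_memLp' (PDAE.memL2_of_continuous hUc))
  have hBU : ∀ t ∈ Icc 0 T, B (U t) = g t := fun t ht => by rw [hUm t ht]; exact hBu ⟨t, ht⟩
  have hdyn : ∀ᵐ t ∂PDAE.timeMeasure T,
      PDAE.toDualV ι (w t) + A (U t) + B.flip (Λ (ℓ t)) = PDAE.toDualV ι (f t (U t)) := by
    filter_upwards [heq, PDAE.ae_timeMeasure_mem_Ioo T] with t h ht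
    have ht' := Ioo_subset_Icc_self ht
    rw [hΛ (ℓ t) fun v hv => ?_]
    · simp only [hℓ, hJ]
      abel
    · have h1 := h ht' v hv
      rw [← hUm t ht', inner_add_left] at h1
      change PDAE.toDualV ι (f t (U t)) v - PDAE.toDualV ι (w t) v - A (U t) v = 0
      rw [hJv, hJv, hAa]
      linarith
  refine ⟨U, fun t => Λ (ℓ t), ⟨hUc.continuousOn, Λ.comp_memLp' hℓ2, ⟨w, hUH1, hdyn⟩, hBU, ?_⟩, ?_⟩
  · rw [hUm 0 ⟨le_rfl, hT.le⟩, hu0]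
  · intro v ν hv
    obtain ⟨v', hv', hvdyn⟩ := hv.dynamic
    let y : C(Icc 0 T, V) :=
      ⟨fun t => v t, continuousOn_iff_continuous_domRestrict.1 hv.continuousOn⟩
    have hιv : ContinuousOn (fun t => ι (v t)) (Icc 0 T) :=
      ι.continuous.comp_continuousOn hv.continuousOn
    have hv'2 : MemLp v' 2 (PDAE.timeMeasure T) := hv'.memL2_deriv
    have hyu : y = u := by
      refine huniq y ⟨hv'2.toLp v', fun t => ?_, fun t => hv.constraint t t.2, hv.initial, ?_⟩
      · rw [PDAE.intervalIntegral_congr_of_ae hv'2.coeFn_toLp t.2]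
        have := hv'.eq_primitive hT hιv t t.2
        rwa [hv.initial] at this
      · filter_upwards [hvdyn, hv'2.coeFn_toLp] with t h1 h2 ht z hz
        have h3 := DFunLike.congr_fun h1 z
        have h4 : B.flip (ν t) z = 0 := by
          have : B z = 0 := hz
          rw [ContinuousLinearMap.flip_apply, this]
          rfl
        rw [add_apply, add_apply, h4, hJv, hJv, hAa] at h3
        rw [h2, inner_add_left]
        change inner ℝ (v' t) (ι z) + a (v t) z = inner ℝ (f t (v t)) (ι z) + inner ℝ (D (v t)) (ι z)
        linarith
    have hvU : EqOn v U (Icc 0 T) := fun t ht => by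
      rw [hUm t ht, ← hyu]
      rfl
    refine ⟨hvU, ?_⟩
    have hderiv := hv'.deriv_ae_eq hUH1 fun t ht => by
      simp only [hvU (Ioo_subset_Icc_self ht)]
    -- Equal states have equal weak derivatives, so the two equations give `B* ν = B* λ`.
    filter_upwards [hvdyn, hdyn, hderiv, PDAE.ae_timeMeasure_mem_Ioo T] with t h1 h2 h3 ht
    rw [hvU (Ioo_subset_Icc_self ht), h3, ← h2] at h1
    exact hB.flip_injective (add_left_cancel h1)
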